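/- Let $n\ge 2$ and consider an $n\times n$ input-queued switch in discrete time. If $q_{ij}(t)\in\mathbb Z_{\ge0}$ is the number of packets waiting at input $i$ for output $j$, then $q_{ij}(t+1)=\max\{q_{ij}(t)+a_{ij}(t)-s_{ij}(t),0\}$. Here $s(t)\in\{0,1\}^{n\times n}$ is the schedule, a matrix with all row and column sums at most $1$, chosen (possibly at random) by a scheduling policy on the basis of the history up to time $t$ including $q(t)$; the arrivals $a(t)\in\mathbb Z_{\ge0}^{n\times n}$ are i.i.d. in $t$, independent of the past and of $s(t)$, with independent entries. Under the MaxWeight policy $s(t)$ is a permutation matrix that maximizes $\sum_{ij}q_{ij}(t)s_{ij}$ over all schedules; ties are broken by any (possibly randomized) rule that depends on $q(t)$ only. Let $\mathcal C=\{x\in\mathbb R_{\ge0}^{n\times n}:\sum_j x_{ij}\le1\ \forall i,\ \sum_i x_{ij}\le1\ \forall j\}$ and $\mathcal F_{10}=\{x\in\mathcal C:\sum_j x_{1j}=1\}$. Let $\nu$ be in the relative interior of $\mathcal F_{10}$ with $\min_{ij}\nu_{ij}>0$. Consider a family of such switches indexed by $0<\epsilon<1$ in which $a^{(\epsilon)}_{ij}(t)\le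 a_{\max}$ for a constant $a_{\max}$ independent of $\epsilon$, $E[a^{(\epsilon)}(t)]=(1-\epsilon)\nu$, and $\mathrm{Var}[a^{(\epsilon)}_{ij}(t)]\to\sigma_{ij}^2$ as $\epsilon\downarrow0$ for all $i,j$. Then, under MaxWeight, for each $\epsilon\in(0,1)$ the queue lengths $q^{(\epsilon)}(t)$ converge in distribution as $t\to\infty$, for every initial law, to a steady-state random matrix $\bar q^{(\epsilon)}$ whose law does not depend on the initial law, and $$\lim_{\epsilon\downarrow0}\epsilon\,E\Big[\sum_j\bar q^{(\epsilon)}_{1j}\Big]=\frac12\sum_j\sigma_{1j}^2,\qquad \lim_{\epsilon\downarrow0}\epsilon\,E\big[\bar q^{(\epsilon)}_{ij}\big]=0\quad\text{for all } i>1 \text{ and all } j.$$ Moreover, MaxWeight is heavy-traffic optimal: for any scheduling policies (which may depend on $\epsilon$) and initial laws for which, for each $\epsilon\in(0,1)$, the queue lengths of the $\epsilon$-th system converge in distribution to a random matrix $\bar r^{(\epsilon)}$ with finite entries, $$\liminf_{\epsilon\downarrow0}\epsilon\,E\Big[\sum_j\bar r^{(\epsilon)}_{1j}\Big]\ \ge\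 \frac12\sum_j\sigma_{1j}^2,$$ the value attained by MaxWeight (expectations are in $[0,\infty]$). -/

import Mathlib

open Filter Topology MeasureTheory ProbabilityTheory
open scoped ENNReal

/-- The capacity region of the `n × n` switch: nonnegative rate matrices all of whose row sums
and column sums are at most `1`. -/
def capacityRegion (n : ℕ) : Set (Fin n → Fin n → ℝ) :=
  {x | (∀ i j, 0 ≤ x i j) ∧ (∀ i, ∑ j, x i j ≤ 1) ∧ (∀ j, ∑ i, x i j ≤ 1)}

/-- The face of the capacity region on which the first `n₁` input ports (rows) and the first
`n₂` output ports (columns) are saturated. -/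
def saturatedFace (n n₁ n₂ : ℕ) : Set (Fin n → Fin n → ℝ) :=
  {x | x ∈ capacityRegion n ∧ (∀ i : Fin n, i.val < n₁ → ∑ j, x i j = 1) ∧
    (∀ j : Fin n, j.val < n₂ → ∑ i, x i j = 1)}

/-- `n × n` matrices of natural numbers: queue lengths, numbers of arrivals, schedules. -/
abbrev SwitchMat (n : ℕ) : Type := Fin n → Fin n → ℕ

/-- Feasible schedules: in every slot each input port is connected to at most one output port
and conversely (so that the entries are `0` or `1`). -/
def IsSchedule {n : ℕ} (s : SwitchMat n) : Prop :=
  (∀ i, ∑ j, s i j ≤ 1) ∧ (∀ j, ∑ i, s i j ≤ 1)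

/-- Maximal schedules, i.e. permutation matrices. -/
def IsMaximalSchedule {n : ℕ} (s : SwitchMat n) : Prop :=
  (∀ i, ∑ j, s i j = 1) ∧ (∀ j, ∑ i, s i j = 1)

/-- The weight of a schedule for given queue lengths. -/
def scheduleWeight {n : ℕ} (q s : SwitchMat n) : ℕ := ∑ i, ∑ j, q i j * s i j

/-- Everything a scheduler may have seen before it chooses a schedule: the current queue lengths,
and the list of the (queue lengths, schedule, arrivals) of all the previous slots, the most recent
slot first. -/
abbrev SwitchHistory (n : ℕ) : Type :=
  SwitchMat n × List (SwitchMat n × SwitchMat n × SwitchMat n)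

/-- A scheduling policy: a random feasible schedule, chosen on the basis of the history. -/
structure SchedulingPolicy (n : ℕ) where
  choose : SwitchHistory n → PMF (SwitchMat n)
  feasible : ∀ h, ∀ s ∈ (choose h).support, IsSchedule s

/-- MaxWeight: the choice depends on the current queue lengths only, and is always a maximal
schedule of the largest weight; ties are broken by an arbitrary, possibly randomized, rule
(for example uniformly at random). -/
def SchedulingPolicy.IsMaxWeight {n : ℕ} (p : SchedulingPolicy n) : Prop :=
  ∃ r : SwitchMat n → PMF (SwitchMat n), (∀ h, p.choose h = r h.1) ∧
    ∀ q, ∀ s ∈ (r q).support, IsMaximalSchedule s ∧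
      ∀ s', IsSchedule s' → scheduleWeight q s' ≤ scheduleWeight q s

/-- One time slot of the switch: a schedule `s` is chosen, then arrivals `a` occur, which are
independent of the past and of `s` and have law `A`, and then queue `(i, j)` becomes
`max (q i j + a i j - s i j) 0` (the subtraction is that of natural numbers). -/
noncomputable def switchStep {n : ℕ} (A : PMF (SwitchMat n)) (p : SchedulingPolicy n)
    (h : SwitchHistory n) : PMF (SwitchHistory n) :=
  (p.choose h).bind fun s => A.map fun a =>
    ((fun i j => h.1 i j + a i j - s i j), (h.1, s, a) :: h.2)

/-- The law of the history at time `t`, with i.i.d. arrivals of law `A` and queue lengths of law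
`init` at time `0`. -/
noncomputable def historyLaw {n : ℕ} (A : PMF (SwitchMat n)) (p : SchedulingPolicy n)
    (init : PMF (SwitchMat n)) : ℕ → PMF (SwitchHistory n)
  | 0 => init.map fun q => (q, [])
  | t + 1 => (historyLaw A p init t).bind (switchStep A p)

/-- The law of the queue lengths at time `t`. -/
noncomputable def queueLaw {n : ℕ} (A : PMF (SwitchMat n)) (p : SchedulingPolicy n)
    (init : PMF (SwitchMat n)) (t : ℕ) : PMF (SwitchMat n) :=
  (historyLaw A p init t).map Prod.fst

/-- The queue lengths converge in distribution to the law `π` (on a countable discrete space this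
is the convergence of the probabilities of all points to those of a probability law). -/
def QueueConvergesTo {n : ℕ} (A : PMF (SwitchMat n)) (p : SchedulingPolicy n)
    (init π : PMF (SwitchMat n)) : Prop :=
  ∀ q, Tendsto (fun t => queueLaw A p init t q) atTop (𝓝 (π q))

/-- `A` is the law of the arrivals in one slot: independent in different queues, at most `amax`
in each of them, and with mean rates `lam`. -/
structure IsArrivalLaw {n : ℕ} (A : PMF (SwitchMat n)) (amax : ℕ)
    (lam : Fin n → Fin n → ℝ) : Prop where
  indep : iIndepFun (fun (ij : Fin n × Fin n) (a : SwitchMat n) => a ij.1 ij.2) A.toMeasure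
  bounded : ∀ a ∈ A.support, ∀ i j, a i j ≤ amax
  mean : ∀ i j, ∫ a, (a i j : ℝ) ∂A.toMeasure = lam i j

/-- The variance of the arrivals to queue `(i, j)` in one slot. -/
noncomputable def arrivalVar {n : ℕ} (A : PMF (SwitchMat n)) (i j : Fin n) : ℝ :=
  variance (fun a : SwitchMat n => (a i j : ℝ)) A.toMeasure

/-- The mean length of queue `(i, j)` under the law `π`, a number in `[0, ∞]`. -/
noncomputable def meanQueue {n : ℕ} (π : PMF (SwitchMat n)) (i j : Fin n) : ℝ≥0∞ :=
  ∫⁻ q, (q i j : ℝ≥0∞) ∂π.toMeasure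

/-- The mean total queue length at input port `i` under the law `π`, a number in `[0, ∞]`. -/
noncomputable def meanRowQueue {n : ℕ} (π : PMF (SwitchMat n)) (i : Fin n) : ℝ≥0∞ :=
  ∫⁻ q, ∑ j, (q i j : ℝ≥0∞) ∂π.toMeasure

/-! Let `r` be the content of the saturated row, `W` the squared distance of the queue matrix from
the line of matrices that are constant on this row and zero elsewhere, and `ε` the gap to full load.

Lower bound, for every policy: a schedule removes at most one packet per slot from the row, so the
new content is at least `(r + a - 1)⁺`, with `a` the arrivals to the row. Testing a limit law with
`r` shows that the row is empty and receives nothing with probability at most `ε`; testing with `r²`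
then gives `2ε E r ≥ ∑ Var + ε² - ε` (`IsArrivalLaw.le_mul_meanRowQueue`). No moment is known in
advance, so the test functions are truncated first.

State space collapse under MaxWeight: since `ν` is in the relative interior of the face and has
positive entries, `ν + δ d` stays in the capacity region for all bounded `d` whose saturated row
sums to zero. By Birkhoff's theorem MaxWeight does at least as well as every such point, so `W` has
drift at most `K - δ √W`, and `W²` has drift at most `C - W`, with constants independent of `ε`
(`exists_integral_perpSq_sq_le`). Hence `E W ≤ C`, which bounds every queue outside the row.

Upper bound: the only excess in the drift of `r²` comes from service wasted on the row. Service is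
wasted only at a queue that ends up empty, and then `r / n` is at most `√W`. Young's inequality with
parameter `L` splits the product into wasted service, absorbed by replacing `r²` with `(r - nL)²`,
and `W / L`, absorbed by adding `(2n / L) W²`. The choice `L = 1 / √ε` leaves an error of order `√ε`
(`exists_steadyState_bounds`).

Convergence to a steady state: the squared norm has a coercive negative drift, which gives an
invariant law by compactness of time averages. Two copies of the chain forget their initial states
by a maximum principle on pairs (`HasDrift.subharmonic_le_zero`), because slots without arrivals
empty the switch and keep it empty. -/

/-! ### Expectations under probability mass functions -/

/-- The expectation of an `[0, ∞]`-valued function under a probability mass function. -/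
noncomputable def pmfExp {α : Type*} (p : PMF α) (F : α → ℝ≥0∞) : ℝ≥0∞ := ∑' x, p x * F x

section PmfExp

variable {α β : Type*}

lemma pmfExp_mono {p : PMF α} {F G : α → ℝ≥0∞} (h : ∀ x ∈ p.support, F x ≤ G x) :
    pmfExp p F ≤ pmfExp p G := by
  refine ENNReal.tsum_le_tsum fun x => ?_
  by_cases hx : x ∈ p.support
  · exact mul_le_mul_right (h x hx) _
  · simp [(PMF.apply_eq_zero_iff p x).2 hx]

lemma pmfExp_const (p : PMF α) (c : ℝ≥0∞) : pmfExp p (fun _ => c) = c := by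
  simp [pmfExp, ENNReal.tsum_mul_right, p.tsum_coe]

lemma pmfExp_add (p : PMF α) (F G : α → ℝ≥0∞) :
    pmfExp p (fun x => F x + G x) = pmfExp p F + pmfExp p G := by
  simp [pmfExp, mul_add, ENNReal.tsum_add]

lemma pmfExp_bind (p : PMF α) (k : α → PMF β) (F : β → ℝ≥0∞) :
    pmfExp (p.bind k) F = pmfExp p fun x => pmfExp (k x) F := by
  simp only [pmfExp, PMF.bind_apply, ← ENNReal.tsum_mul_right, ← ENNReal.tsum_mul_left, mul_assoc]
  exact ENNReal.tsum_comm

lemma pmfExp_pure (a : α) (F : α → ℝ≥0∞) : pmfExp (PMF.pure a) F = F a := by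
  rw [pmfExp, tsum_eq_single a]
  · simp
  · intro b hb; simp [PMF.pure_apply, hb]

lemma pmfExp_map (p : PMF α) (f : α → β) (F : β → ℝ≥0∞) :
    pmfExp (p.map f) F = pmfExp p fun x => F (f x) := by
  rw [← PMF.bind_pure_comp, pmfExp_bind]
  simp [pmfExp_pure]

/-- Both total masses are `1`, so a strict inequality anywhere would make the sums differ. Thanks to
this, invariance of a law needs only one inequality. -/
lemma PMF.eq_of_le {p q : PMF α} (h : ∀ x, p x ≤ q x) : p = q := by
  by_contra hne
  obtain ⟨x, hx⟩ : ∃ x, p x ≠ q x := by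
    by_contra! hc
    exact hne (PMF.ext hc)
  have := ENNReal.tsum_lt_tsum (f := p) (g := q) (by simp [p.tsum_coe]) h
    (lt_of_le_of_ne (h x) hx)
  simp [p.tsum_coe, q.tsum_coe] at this

end PmfExp

section Measurable

variable {S : Type*} [Countable S] [MeasurableSpace S] [MeasurableSingletonClass S]

lemma lintegral_toMeasure_eq_pmfExp (p : PMF S) (F : S → ℝ≥0∞) :
    ∫⁻ x, F x ∂p.toMeasure = pmfExp p F := by
  rw [lintegral_countable', pmfExp]
  simp [PMF.toMeasure_apply_singleton, mul_comm]

lemma PMF.ae_mem_support (p : PMF S) : ∀ᵐ x ∂p.toMeasure, x ∈ p.support := by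
  rw [ae_iff, PMF.toMeasure_apply_eq_zero_iff _ (Set.to_countable _).measurableSet]
  exact Set.disjoint_left.2 fun x hx hx' => hx' hx

lemma PMF.ae_iff_forall_mem_support (p : PMF S) {Q : S → Prop} :
    (∀ᵐ x ∂p.toMeasure, Q x) ↔ ∀ x ∈ p.support, Q x := by
  refine ⟨fun h x hx => ?_, fun h => p.ae_mem_support.mono h⟩
  rw [ae_iff, PMF.toMeasure_apply_eq_zero_iff _ (Set.to_countable _).measurableSet] at h
  by_contra hn
  exact Set.disjoint_left.1 h hx hn

lemma PMF.integrable_of_bound (p : PMF S) {f : S → ℝ} (C : ℝ) (h : ∀ x ∈ p.support, |f x| ≤ C) :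
    Integrable f p.toMeasure :=
  Integrable.of_bound (measurable_of_countable f).aestronglyMeasurable C
    (p.ae_iff_forall_mem_support.2 h)

lemma PMF.integrable_of_finite_support (p : PMF S) (h : p.support.Finite) (f : S → ℝ) :
    Integrable f p.toMeasure := by
  obtain ⟨C, hC⟩ := (h.image fun x => |f x|).bddAbove
  exact p.integrable_of_bound C fun x hx => hC ⟨x, hx, rfl⟩

lemma pmfExp_ofReal (p : PMF S) {f : S → ℝ} (hf : Integrable f p.toMeasure) (h0 : ∀ x, 0 ≤ f x) :
    pmfExp p (fun x => ENNReal.ofReal (f x)) = ENNReal.ofReal (∫ x, f x ∂p.toMeasure) := by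
  rw [ofReal_integral_eq_lintegral_ofReal hf (.of_forall h0), lintegral_toMeasure_eq_pmfExp]

lemma integrable_of_pmfExp_le (p : PMF S) {f : S → ℝ} {c : ℝ} (h0 : ∀ x, 0 ≤ f x)
    (h : pmfExp p (fun x => ENNReal.ofReal (f x)) ≤ ENNReal.ofReal c) :
    Integrable f p.toMeasure := by
  refine ⟨(measurable_of_countable f).aestronglyMeasurable, ?_⟩
  rw [hasFiniteIntegral_iff_ofReal (.of_forall h0), lintegral_toMeasure_eq_pmfExp]
  exact h.trans_lt ENNReal.ofReal_lt_top

lemma integral_le_of_pmfExp_le (p : PMF S) {f : S → ℝ} {c : ℝ} (h0 : ∀ x, 0 ≤ f x) (hc : 0 ≤ c)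
    (h : pmfExp p (fun x => ENNReal.ofReal (f x)) ≤ ENNReal.ofReal c) :
    ∫ x, f x ∂p.toMeasure ≤ c := by
  rw [pmfExp_ofReal p (integrable_of_pmfExp_le p h0 h) h0] at h
  exact (ENNReal.ofReal_le_ofReal_iff hc).1 h

lemma toReal_bind_apply (p : PMF S) (k : S → PMF S) (q : S) :
    ((p.bind k) q).toReal = ∫ x, (k x q).toReal ∂p.toMeasure := by
  have hk : ∀ x, k x q ≠ ∞ := fun x => PMF.apply_ne_top _ _
  have hi : Integrable (fun x => (k x q).toReal) p.toMeasure :=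
    p.integrable_of_bound 1 fun x _ => by
      rw [abs_of_nonneg ENNReal.toReal_nonneg]
      exact ENNReal.toReal_le_of_le_ofReal zero_le_one (by simpa using PMF.coe_le_one _ _)
  have := pmfExp_ofReal p hi fun _ => ENNReal.toReal_nonneg
  simp only [ENNReal.ofReal_toReal (hk _)] at this
  rw [PMF.bind_apply, ← pmfExp, this, ENNReal.toReal_ofReal]
  exact integral_nonneg fun _ => ENNReal.toReal_nonneg

/-- If the values of an integrable function do not exceed its mean, it is a.s. constant. -/
lemma PMF.eq_of_forall_le_integral (p : PMF S) {f : S → ℝ} {M : ℝ} (hf : Integrable f p.toMeasure)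
    (hM : ∀ x, f x ≤ M) (h : M ≤ ∫ x, f x ∂p.toMeasure) {x : S} (hx : x ∈ p.support) :
    f x = M := by
  have h0 : ∫ x, (M - f x) ∂p.toMeasure = 0 := by
    refine le_antisymm ?_ (integral_nonneg fun x => sub_nonneg.2 (hM x))
    rw [integral_sub (integrable_const _) hf]
    simpa using h
  rw [integral_eq_zero_iff_of_nonneg (fun x => sub_nonneg.2 (hM x))
    ((integrable_const _).sub hf)] at h0
  have := (p.ae_iff_forall_mem_support (Q := fun x => M - f x = 0)).1 h0 x hx
  linarith

/-! ### Convergence of probability mass functions -/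

/-- Fatou's lemma for pointwise convergence: a finite partial sum already exceeds `c`, and finite
sums converge. -/
lemma eventually_lt_pmfExp {α ι : Type*} {l : Filter ι} {L : ι → PMF α} {π : PMF α}
    (hL : ∀ q, Tendsto (fun t => L t q) l (𝓝 (π q))) {F : α → ℝ≥0∞} (hF : ∀ q, F q ≠ ∞)
    {c : ℝ≥0∞} (hc : c < pmfExp π F) : ∀ᶠ t in l, c < pmfExp (L t) F := by
  rw [pmfExp, ENNReal.tsum_eq_iSup_sum, lt_iSup_iff] at hc
  obtain ⟨T, hT⟩ := hc
  have : Tendsto (fun t => ∑ q ∈ T, L t q * F q) l (𝓝 (∑ q ∈ T, π q * F q)) :=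
    tendsto_finsetSum _ fun q _ => ENNReal.Tendsto.mul_const (hL q) (Or.inr (hF q))
  exact (this.eventually (lt_mem_nhds hT)).mono fun t ht => ht.trans_le (ENNReal.sum_le_tsum T)

/-- No mass escapes because the limit is itself a probability law. Lower semicontinuity for the
nonnegative functions `B + F` and `B - F` gives both halves. -/
lemma tendsto_integral_of_tendsto_pmf {ι : Type*} {l : Filter ι} {L : ι → PMF S} {π : PMF S}
    (hL : ∀ q, Tendsto (fun t => L t q) l (𝓝 (π q))) {F : S → ℝ} {B : ℝ} (hF : ∀ q, |F q| ≤ B) :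
    Tendsto (fun t => ∫ q, F q ∂(L t).toMeasure) l (𝓝 (∫ q, F q ∂π.toMeasure)) := by
  have key : ∀ G : S → ℝ, (∀ q, |G q| ≤ B) → ∀ c < ∫ q, G q ∂π.toMeasure,
      ∀ᶠ t in l, c < ∫ q, G q ∂(L t).toMeasure := by
    intro G hG c hc
    have hi : ∀ p : PMF S, Integrable G p.toMeasure := fun p =>
      p.integrable_of_bound B fun x _ => hG x
    have h0 : ∀ q, 0 ≤ G q + B := fun q => by linarith [neg_abs_le (G q), hG q]
    have he : ∀ p : PMF S, pmfExp p (fun q => ENNReal.ofReal (G q + B)) =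
        ENNReal.ofReal (∫ q, G q ∂p.toMeasure + B) := fun p => by
      rw [pmfExp_ofReal p (f := fun q => G q + B) ((hi p).add (integrable_const _)) h0,
        integral_add (hi p) (integrable_const _)]
      simp
    rcases lt_or_ge (c + B) 0 with hcB | hcB
    · refine .of_forall fun t => ?_
      have : 0 ≤ ∫ q, (G q + B) ∂(L t).toMeasure := integral_nonneg h0
      rw [integral_add (hi _) (integrable_const _)] at this
      simp only [integral_const, probReal_univ, one_smul] at this
      linarith
    · have h1 : ENNReal.ofReal (c + B) < pmfExp π (fun q => ENNReal.ofReal (G q + B)) := by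
        rw [he]
        exact (ENNReal.ofReal_lt_ofReal_iff (by linarith)).2 (by linarith)
      filter_upwards [eventually_lt_pmfExp hL (fun q => ENNReal.ofReal_ne_top) h1] with t ht
      rw [he] at ht
      have := (ENNReal.ofReal_lt_ofReal_iff_of_nonneg hcB).1 ht
      linarith
  refine tendsto_order.2 ⟨key F hF, fun c hc => ?_⟩
  have := key (fun q => -F q) (fun q => by simpa using hF q) (-c)
    (by rw [integral_neg]; linarith)
  simpa [integral_neg] using this

/-! ### Markov chains on countable state spaces -/

/-- The law at time `t` of the Markov chain with transition probabilities `P` and initial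
law `μ`. -/
noncomputable def markovLaw {S : Type*} (P : S → PMF S) (μ : PMF S) : ℕ → PMF S
  | 0 => μ
  | t + 1 => (markovLaw P μ t).bind P

lemma markovLaw_bind {S T : Type*} (P : S → PMF S) (μ : PMF T) (k : T → PMF S) (t : ℕ) :
    markovLaw P (μ.bind k) t = μ.bind fun x => markovLaw P (k x) t := by
  induction t with
  | zero => rfl
  | succ t ih => simp [markovLaw, ih, PMF.bind_bind]

lemma markovLaw_succ {S : Type*} (P : S → PMF S) (μ : PMF S) (t : ℕ) :
    markovLaw P μ (t + 1) = markovLaw P (μ.bind P) t := by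
  induction t with
  | zero => rfl
  | succ t ih => rw [markovLaw, ih, markovLaw]

lemma markovLaw_of_invariant {S : Type*} {P : S → PMF S} {π : PMF S} (h : π.bind P = π) (t : ℕ) :
    markovLaw P π t = π := by
  induction t with
  | zero => rfl
  | succ t ih => rw [markovLaw, ih, h]

/-- Foster's drift condition for the chain `P`: the mean increment of `f` in a step from `x` is at
most `b - g x`. -/
def HasDrift (P : S → PMF S) (f g : S → ℝ) (b : ℝ) : Prop :=
  ∀ x, Integrable f (P x).toMeasure ∧ ∫ y, f y ∂(P x).toMeasure ≤ f x - g x + b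

variable {P : S → PMF S} {f g : S → ℝ} {b : ℝ}

lemma HasDrift.pmfExp_add_le (h : HasDrift P f g b) (hf : ∀ x, 0 ≤ f x) (hg : ∀ x, 0 ≤ g x)
    (hb : 0 ≤ b) (x : S) : pmfExp (P x) (fun y => ENNReal.ofReal (f y)) + ENNReal.ofReal (g x) ≤
      ENNReal.ofReal (f x) + ENNReal.ofReal b := by
  rw [pmfExp_ofReal _ (h x).1 hf, ← ENNReal.ofReal_add (integral_nonneg hf) (hg x),
    ← ENNReal.ofReal_add (hf x) hb]
  exact ENNReal.ofReal_le_ofReal (by linarith [(h x).2])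

/-- The one-step drift inequality telescopes. Working in `[0, ∞]` avoids any integrability question
for `g`. -/
lemma HasDrift.sum_le (h : HasDrift P f g b) (hf : ∀ x, 0 ≤ f x) (hg : ∀ x, 0 ≤ g x)
    (hb : 0 ≤ b) (o : S) (T : ℕ) :
    pmfExp (markovLaw P (PMF.pure o) T) (fun y => ENNReal.ofReal (f y)) +
      ∑ t ∈ Finset.range T, pmfExp (markovLaw P (PMF.pure o) t) (fun y => ENNReal.ofReal (g y)) ≤
      ENNReal.ofReal (f o) + T * ENNReal.ofReal b := by
  induction T with
  | zero => simp [markovLaw, pmfExp_pure]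
  | succ T ih =>
    rw [Finset.sum_range_succ, markovLaw, pmfExp_bind]
    set μ := markovLaw P (PMF.pure o) T
    have h1 := pmfExp_mono (p := μ) fun x _ => h.pmfExp_add_le hf hg hb x
    rw [pmfExp_add, pmfExp_add, pmfExp_const] at h1
    calc _ = (pmfExp μ (fun x => pmfExp (P x) fun y => ENNReal.ofReal (f y)) +
          pmfExp μ fun y => ENNReal.ofReal (g y)) + ∑ t ∈ Finset.range T,
            pmfExp (markovLaw P (PMF.pure o) t) (fun y => ENNReal.ofReal (g y)) := by ring
      _ ≤ (pmfExp μ (fun x => ENNReal.ofReal (f x)) + ENNReal.ofReal b) + ∑ t ∈ Finset.range T,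
            pmfExp (markovLaw P (PMF.pure o) t) (fun y => ENNReal.ofReal (g y)) := by gcongr
      _ = (pmfExp μ (fun x => ENNReal.ofReal (f x)) + ∑ t ∈ Finset.range T,
            pmfExp (markovLaw P (PMF.pure o) t) (fun y => ENNReal.ofReal (g y))) +
            ENNReal.ofReal b := by ring
      _ ≤ _ := by
        refine (add_le_add_left ih _).trans_eq ?_
        push_cast; ring

/-- A drift condition bounds the mean of `g` in the steady state. -/
lemma HasDrift.pmfExp_le (h : HasDrift P f g b) (hf : ∀ x, 0 ≤ f x) (hg : ∀ x, 0 ≤ g x)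
    (hb : 0 ≤ b) {o : S} {π : PMF S}
    (hπ : ∀ q, Tendsto (fun t => markovLaw P (PMF.pure o) t q) atTop (𝓝 (π q))) :
    pmfExp π (fun y => ENNReal.ofReal (g y)) ≤ ENNReal.ofReal b := by
  rw [pmfExp, ENNReal.tsum_eq_iSup_sum]
  refine iSup_le fun T => ?_
  -- The mean of `g` restricted to a finite set passes to the limit in `t`. Its Cesàro means have
  -- the same limit and are at most `f o / n + b`.
  set w : ℕ → ℝ := fun t => ∑ q ∈ T, (markovLaw P (PMF.pure o) t q).toReal * g q with hw
  have hw0 : ∀ t, 0 ≤ w t := fun t =>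
    Finset.sum_nonneg fun q _ => mul_nonneg ENNReal.toReal_nonneg (hg q)
  have hwE : ∀ p : PMF S, ENNReal.ofReal (∑ q ∈ T, (p q).toReal * g q) =
      ∑ q ∈ T, p q * ENNReal.ofReal (g q) := fun p => by
    rw [ENNReal.ofReal_sum_of_nonneg fun q _ => mul_nonneg ENNReal.toReal_nonneg (hg q)]
    refine Finset.sum_congr rfl fun q _ => ?_
    rw [ENNReal.ofReal_mul ENNReal.toReal_nonneg, ENNReal.ofReal_toReal (PMF.apply_ne_top _ _)]
  have hlim : Tendsto w atTop (𝓝 (∑ q ∈ T, (π q).toReal * g q)) :=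
    tendsto_finsetSum _ fun q _ =>
      ((ENNReal.tendsto_toReal (PMF.apply_ne_top _ _)).comp (hπ q)).mul_const _
  have hsum : ∀ n : ℕ, ∑ t ∈ Finset.range n, w t ≤ f o + n * b := fun n => by
    have h1 := (le_add_self).trans (h.sum_le hf hg hb o n)
    have h2 : ENNReal.ofReal (∑ t ∈ Finset.range n, w t) ≤ ENNReal.ofReal (f o + n * b) := by
      rw [ENNReal.ofReal_sum_of_nonneg fun t _ => hw0 t, ENNReal.ofReal_add (hf o) (by positivity),
        ENNReal.ofReal_mul (by positivity), ENNReal.ofReal_natCast]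
      refine le_trans (Finset.sum_le_sum fun t _ => ?_) h1
      rw [hwE]
      exact ENNReal.sum_le_tsum T
    exact (ENNReal.ofReal_le_ofReal_iff (by have := hf o; positivity)).1 h2
  rw [← hwE]
  refine ENNReal.ofReal_le_ofReal ?_
  have hr : Tendsto (fun n : ℕ => (n : ℝ)⁻¹ * f o + b) atTop (𝓝 (0 * f o + b)) :=
    (tendsto_inv_atTop_nhds_zero_nat.mul_const _).add_const _
  rw [zero_mul, zero_add] at hr
  refine le_of_tendsto_of_tendsto hlim.cesaro hr ?_
  filter_upwards [eventually_gt_atTop 0] with n hn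
  have hn' : (0 : ℝ) < n := by exact_mod_cast hn
  calc (n : ℝ)⁻¹ * ∑ t ∈ Finset.range n, w t ≤ (n : ℝ)⁻¹ * (f o + n * b) := by
        gcongr; exact hsum n
    _ = _ := by field_simp

lemma tendsto_ennreal_const_div_nat {c : ℝ≥0∞} (hc : c ≠ ∞) :
    Tendsto (fun n : ℕ => c / n) atTop (𝓝 0) := by
  simpa [div_eq_mul_inv] using
    ENNReal.Tendsto.const_mul ENNReal.tendsto_inv_nat_nhds_zero (Or.inr hc)

/-- Existence of an invariant law from a coercive drift condition. -/
lemma HasDrift.exists_invariant (h : HasDrift P f g b) (hf : ∀ x, 0 ≤ f x) (hg : ∀ x, 0 ≤ g x)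
    (hb : 0 ≤ b) (hfin : ∀ R : ℝ, {x | g x ≤ R}.Finite) (o : S) :
    ∃ π : PMF S, π.bind P = π := by
  set μ := markovLaw P (PMF.pure o) with hμ
  set m : ℕ → S → ℝ≥0∞ := fun n q => (∑ t ∈ Finset.range n, μ t q) / n with hm
  -- Time averages converge at all states simultaneously along a free ultrafilter, without
  -- extraction of subsequences.
  have hcomp : ∀ q, ∃ c : ℝ≥0∞, Tendsto (fun n => m n q) (hyperfilter ℕ : Filter ℕ) (𝓝 c) := by
    intro q
    obtain ⟨c, _, hc⟩ := isCompact_univ.ultrafilter_le_nhds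
      ((hyperfilter ℕ).map fun n => m n q) (by simp)
    exact ⟨c, hc⟩
  choose p hp using hcomp
  have hpos : ∀ᶠ n : ℕ in (hyperfilter ℕ : Filter ℕ), 0 < n :=
    (Nat.hyperfilter_le_atTop) (eventually_gt_atTop 0)
  have htot : ∀ n, 0 < n → ∑' q, m n q = 1 := by
    intro n hn
    simp only [hm, div_eq_mul_inv, ENNReal.tsum_mul_right]
    rw [Summable.tsum_finsetSum fun _ _ => ENNReal.summable]
    simp only [PMF.tsum_coe, Finset.sum_const, Finset.card_range, nsmul_eq_mul, mul_one]
    exact ENNReal.mul_inv_cancel (by simp [hn.ne']) (by simp)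
  have hle : ∑' q, p q ≤ 1 := by
    rw [ENNReal.tsum_eq_iSup_sum]
    refine iSup_le fun T => ?_
    refine le_of_tendsto (tendsto_finsetSum T fun q _ => hp q) ?_
    filter_upwards [hpos] with n hn
    exact (ENNReal.sum_le_tsum T).trans_eq (htot n hn)
  set B := ENNReal.ofReal (f o) + ENNReal.ofReal b with hB
  have hmg : ∀ n, 0 < n → ∑' q, m n q * ENNReal.ofReal (g q) ≤ B := by
    intro n hn
    have hn0 : (n : ℝ≥0∞) ≠ 0 := by simp [hn.ne']
    have h1 := (le_add_self).trans (h.sum_le hf hg hb o n)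
    simp only [hm, div_eq_mul_inv]
    calc ∑' q, (∑ t ∈ Finset.range n, μ t q) * (n : ℝ≥0∞)⁻¹ * ENNReal.ofReal (g q)
        = (∑ t ∈ Finset.range n, pmfExp (μ t) fun q => ENNReal.ofReal (g q)) * (n : ℝ≥0∞)⁻¹ := by
          simp only [pmfExp]
          rw [← Summable.tsum_finsetSum fun _ _ => ENNReal.summable, ← ENNReal.tsum_mul_right]
          refine tsum_congr fun q => ?_
          rw [← Finset.sum_mul]; ring
      _ ≤ (ENNReal.ofReal (f o) + n * ENNReal.ofReal b) * (n : ℝ≥0∞)⁻¹ := by gcongr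
      _ = ENNReal.ofReal (f o) * (n : ℝ≥0∞)⁻¹ + ENNReal.ofReal b * (n * (n : ℝ≥0∞)⁻¹) := by ring
      _ ≤ ENNReal.ofReal (f o) * 1 + ENNReal.ofReal b * 1 := by
          gcongr
          · exact ENNReal.inv_le_one.2 (by exact_mod_cast hn)
          · exact ENNReal.mul_inv_le_one _
      _ = B := by simp [hB]
  have hBtop : B ≠ ∞ := by simp [hB]
  -- Tightness: by Markov's inequality, the averages put mass at most `B / R` outside the finite set
  -- where `g ≤ R`, so the ultrafilter limit loses no mass.
  have hge : 1 ≤ ∑' q, p q := by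
    have hR : ∀ R : ℕ, 0 < R → 1 ≤ ∑' q, p q + B / R := by
      intro R hR
      set T := (hfin R).toFinset
      have hR0 : (R : ℝ≥0∞) ≠ 0 := by simp [hR.ne']
      have h1 : ∀ n, 0 < n → 1 ≤ ∑ q ∈ T, m n q + B / R := by
        intro n hn
        rw [← htot n hn]
        calc ∑' q, m n q ≤ ∑' q, ((T : Set S).indicator (m n) q +
              m n q * ENNReal.ofReal (g q) * (R : ℝ≥0∞)⁻¹) := by
              refine ENNReal.tsum_le_tsum fun q => ?_
              by_cases hq : q ∈ T
              · simp [hq]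
              · have hgR : (R : ℝ≥0∞) ≤ ENNReal.ofReal (g q) := by
                  rw [← ENNReal.ofReal_natCast]
                  refine ENNReal.ofReal_le_ofReal ?_
                  simp only [T, Set.Finite.mem_toFinset, Set.mem_ofPred_eq, not_le] at hq
                  exact hq.le
                calc m n q = m n q * (R * (R : ℝ≥0∞)⁻¹) := by
                      rw [ENNReal.mul_inv_cancel hR0 (by simp), mul_one]
                  _ ≤ m n q * (ENNReal.ofReal (g q) * (R : ℝ≥0∞)⁻¹) := by gcongr
                  _ = m n q * ENNReal.ofReal (g q) * (R : ℝ≥0∞)⁻¹ := by ring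
                  _ ≤ _ := le_add_self
          _ = ∑ q ∈ T, m n q + (∑' q, m n q * ENNReal.ofReal (g q)) * (R : ℝ≥0∞)⁻¹ := by
              rw [ENNReal.tsum_add, ENNReal.tsum_mul_right, sum_eq_tsum_indicator]
          _ ≤ _ := by
              rw [div_eq_mul_inv]; gcongr; exact hmg n hn
      have h2 : 1 ≤ ∑ q ∈ T, p q + B / R := by
        refine ge_of_tendsto ((tendsto_finsetSum T fun q _ => hp q).add_const _) ?_
        filter_upwards [hpos] with n hn using h1 n hn
      exact h2.trans (by gcongr; exact ENNReal.sum_le_tsum T)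
    have hlim : Tendsto (fun R : ℕ => ∑' q, p q + B / R) atTop (𝓝 (∑' q, p q + 0)) :=
      (tendsto_ennreal_const_div_nat hBtop).const_add _
    rw [add_zero] at hlim
    refine ge_of_tendsto hlim ?_
    filter_upwards [eventually_gt_atTop 0] with R hR' using hR R hR'
  set π : PMF S := ⟨p, by rw [← le_antisymm hle hge]; exact ENNReal.summable.hasSum⟩ with hπ
  have hπp : ∀ q, π q = p q := fun q => rfl
  refine ⟨π, PMF.eq_of_le fun q => ?_⟩
  rw [PMF.bind_apply, ENNReal.tsum_eq_iSup_sum]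
  refine iSup_le fun T => ?_
  simp only [hπp]
  -- A finite part of the averaged law after one more step exceeds the average itself by at most `1
  -- / n`, the boundary term of the shifted sum.
  have hlim1 : Tendsto (fun n => ∑ x ∈ T, m n x * P x q) (hyperfilter ℕ : Filter ℕ)
      (𝓝 (∑ x ∈ T, p x * P x q)) :=
    tendsto_finsetSum T fun x _ =>
      ENNReal.Tendsto.mul_const (hp x) (Or.inr (PMF.apply_ne_top _ _))
  have hlim2 : Tendsto (fun n : ℕ => m n q + 1 / n) (hyperfilter ℕ : Filter ℕ) (𝓝 (p q + 0)) :=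
    (hp q).add ((tendsto_ennreal_const_div_nat ENNReal.one_ne_top).mono_left
      Nat.hyperfilter_le_atTop)
  rw [add_zero] at hlim2
  refine le_of_tendsto_of_tendsto hlim1 hlim2 ?_
  refine .of_forall fun n => ?_
  calc ∑ x ∈ T, m n x * P x q ≤ ∑' x, m n x * P x q := ENNReal.sum_le_tsum T
    _ = (∑ t ∈ Finset.range n, μ (t + 1) q) / n := by
        simp only [hm, div_eq_mul_inv]
        have : ∀ t, μ (t + 1) q = ∑' x, μ t x * P x q := fun t => by
          rw [hμ, markovLaw, PMF.bind_apply]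
        simp only [this]
        rw [← Summable.tsum_finsetSum fun _ _ => ENNReal.summable, ← ENNReal.tsum_mul_right]
        refine tsum_congr fun x => ?_
        rw [← Finset.sum_mul]; ring
    _ ≤ (∑ t ∈ Finset.range n, μ t q + 1) / n := by
        gcongr
        calc _ ≤ ∑ t ∈ Finset.range (n + 1), μ t q := by
              rw [Finset.sum_range_succ']; exact le_self_add
          _ ≤ _ := by rw [Finset.sum_range_succ]; gcongr; exact PMF.coe_le_one _ _
    _ = m n q + 1 / n := by rw [ENNReal.add_div]

end Measurable

/-! ### Loss of memory and convergence to the steady state -/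

section Ergodic

variable {S : Type*} [Countable S] [MeasurableSpace S] [MeasurableSingletonClass S]
  {P : S → PMF S} {f g : S → ℝ} {b : ℝ}

/-- A bounded function on `S × S` that is subharmonic for two independent copies of a chain with
a coercive drift condition, and vanishes at `(o, o)`, is nonpositive, if from every point the
chain may go down to `o`. -/
lemma HasDrift.subharmonic_le_zero (h : HasDrift P f g b) (hf : ∀ x, 0 ≤ f x) (hg : ∀ x, 0 ≤ g x)
    (hffin : ∀ R : ℝ, {x | f x ≤ R}.Finite) (hgfin : ∀ R : ℝ, {x | g x ≤ R}.Finite)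
    {o : S} {ℓ : S → ℕ} (hℓ : ∀ x, ∃ y ∈ (P x).support, ℓ y < ℓ x ∨ (x = o ∧ y = o))
    {k : S → S → ℝ} (hk0 : ∀ x y, 0 ≤ k x y) (hk1 : ∀ x y, k x y ≤ 1) (hko : k o o = 0)
    (hk : ∀ x y, k x y ≤ ∫ x', ∫ y', k x' y' ∂(P y).toMeasure ∂(P x).toMeasure) (x y : S) :
    k x y ≤ 0 := by
  have hki : ∀ y x', Integrable (fun y' => k x' y') (P y).toMeasure := fun y x' =>
    (P y).integrable_of_bound 1 fun y' _ => by
      rw [abs_of_nonneg (hk0 _ _)]; exact hk1 _ _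
  have hk2 : ∀ y x', ∫ y', k x' y' ∂(P y).toMeasure ≤ 1 := fun y x' => by
    have := integral_mono (hki y x') (integrable_const (1 : ℝ)) (fun y' => hk1 x' y')
    simpa using this
  have hkii : ∀ x y, Integrable (fun x' => ∫ y', k x' y' ∂(P y).toMeasure) (P x).toMeasure :=
    fun x y => (P x).integrable_of_bound 1 fun x' _ => by
      rw [abs_of_nonneg (integral_nonneg fun y' => hk0 _ _)]; exact hk2 _ _
  -- Outside this finite set, the drift of `f z.1 + f z.2` for the pair of chains is below `-1`. The
  -- point `(o, o)` is inserted to make the set nonempty.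
  set C : Set (S × S) := insert (o, o) {z | g z.1 + g z.2 ≤ 2 * b + 1} with hC
  have hCfin : C.Finite := by
    refine Set.Finite.insert _ (((hgfin (2 * b + 1)).prod (hgfin (2 * b + 1))).subset ?_)
    intro z hz
    have hz' : g z.1 + g z.2 ≤ 2 * b + 1 := hz
    exact ⟨show g z.1 ≤ _ by linarith [hg z.2], show g z.2 ≤ _ by linarith [hg z.1]⟩
  obtain ⟨z₀, hz₀, hmax⟩ := Set.exists_max_image C (fun z => k z.1 z.2) hCfin ⟨_, Set.mem_insert _ _⟩
  set M := k z₀.1 z₀.2 with hM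
  -- Maximum principle: the penalized function `φ` attains its maximum, because `k` is bounded and
  -- `f` coercive. Outside `C` the penalty strictly decreases in mean while `k` does not, so `φ`
  -- would exceed its maximum.
  have hη : ∀ η > 0, ∀ z : S × S, k z.1 z.2 ≤ M + η * (f z.1 + f z.2) := by
    intro η hη z₁
    by_contra! hz₁
    set φ : S × S → ℝ := fun z => k z.1 z.2 - η * (f z.1 + f z.2) with hφ
    have hEfin : {z | φ z₁ ≤ φ z}.Finite := by
      set R := (1 - φ z₁) / η
      refine ((hffin R).prod (hffin R)).subset fun z hz => ?_
      have hz' : φ z₁ ≤ k z.1 z.2 - η * (f z.1 + f z.2) := hz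
      have : f z.1 + f z.2 ≤ R := by
        rw [le_div_iff₀ hη]; linarith [hk1 z.1 z.2]
      exact ⟨show f z.1 ≤ R by linarith [hf z.2], show f z.2 ≤ R by linarith [hf z.1]⟩
    obtain ⟨z₂, hz₂, hmax₂⟩ := Set.exists_max_image _ φ hEfin ⟨z₁, le_refl (φ z₁)⟩
    have hglob : ∀ z, φ z ≤ φ z₂ := fun z => by
      by_cases hz : φ z₁ ≤ φ z
      · exact hmax₂ z hz
      · exact (not_le.1 hz).le.trans hz₂
    have hnC : z₂ ∉ C := fun hc => by
      have h1 := hmax z₂ hc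
      have h2 : φ z₁ ≤ φ z₂ := hz₂
      simp only [hφ] at h2
      have := mul_nonneg hη.le (add_nonneg (hf z₂.1) (hf z₂.2))
      linarith
    have hgz : 2 * b + 1 < g z₂.1 + g z₂.2 := by
      by_contra! hc
      exact hnC (Set.mem_insert_of_mem _ hc)
    have hfi := fun x => (h x).1
    have haff : ∀ x α, Integrable (fun y => α + η * f y) (P x).toMeasure ∧
        ∫ y, (α + η * f y) ∂(P x).toMeasure = α + η * ∫ y, f y ∂(P x).toMeasure := fun x α => by
      refine ⟨(integrable_const _).add ((hfi x).const_mul _), ?_⟩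
      rw [integral_add (integrable_const _) ((hfi x).const_mul _), integral_const_mul]
      simp
    have hub : k z₂.1 z₂.2 ≤ φ z₂ + η * ∫ x, f x ∂(P z₂.2).toMeasure +
        η * ∫ x, f x ∂(P z₂.1).toMeasure := by
      refine (hk z₂.1 z₂.2).trans ?_
      rw [← (haff z₂.1 _).2]
      refine integral_mono (hkii _ _) (haff _ _).1 fun x' => ?_
      have h1 := integral_mono (hki z₂.2 x') (haff z₂.2 (φ z₂ + η * f x')).1 fun y' => by
        have := hglob (x', y')
        simp only [hφ] at this ⊢
        linarith
      rw [(haff _ _).2] at h1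
      exact h1.trans_eq (by ring)
    have h1 := (h z₂.1).2
    have h2 := (h z₂.2).2
    simp only [hφ] at hub
    nlinarith
  have hle : ∀ x y, k x y ≤ M := by
    intro x y
    by_contra! hc
    have hV : 0 ≤ f x + f y := add_nonneg (hf x) (hf y)
    -- This `η` makes the penalty at most half of the supposed excess over `M`; it plays the part of
    -- `η → 0`.
    have h1 := hη ((k x y - M) / (2 * (f x + f y + 1))) (by
      have : 0 < k x y - M := by linarith
      positivity) (x, y)
    have h2 : (k x y - M) / (2 * (f x + f y + 1)) * (f x + f y) ≤ (k x y - M) / 2 := by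
      rw [div_mul_eq_mul_div, div_le_div_iff₀ (by positivity) (by norm_num)]
      nlinarith
    simp only at h1
    linarith
  -- At a point where the maximum `M` is attained, subharmonicity forces the value `M` at every
  -- possible successor. Each coordinate descends in `ℓ` or waits at `o`, so the pair reaches `(o,
  -- o)`, where `k` vanishes.
  have hdesc : ∀ n x y, ℓ x + ℓ y = n → k x y = M → M = 0 := by
    intro n
    induction n using Nat.strong_induction_on with
    | _ n ih =>
      intro x y hn hxy
      obtain ⟨x', hx', hxx⟩ := hℓ x
      obtain ⟨y', hy', hyy⟩ := hℓ y
      have hin : ∀ x', ∫ y', k x' y' ∂(P y).toMeasure ≤ M := fun x' => by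
        have := integral_mono (hki y x') (integrable_const M) (fun y' => hle x' y')
        simpa using this
      have h1 := (P x).eq_of_forall_le_integral (hkii x y) hin (hxy ▸ hk x y) hx'
      have h2 := (P y).eq_of_forall_le_integral (hki y x') (hle x') h1.ge hy'
      by_cases hoo : (x = o ∧ x' = o) ∧ y = o ∧ y' = o
      · rw [hoo.1.2, hoo.2.2, hko] at h2
        exact h2.symm
      · refine ih (ℓ x' + ℓ y') ?_ x' y' rfl h2
        have hx2 : ℓ x' ≤ ℓ x := hxx.elim le_of_lt fun hx => by rw [hx.1, hx.2]
        have hy2 : ℓ y' ≤ ℓ y := hyy.elim le_of_lt fun hy => by rw [hy.1, hy.2]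
        rcases hxx with hxx | hxx
        · omega
        · rcases hyy with hyy | hyy
          · omega
          · exact absurd ⟨hxx, hyy⟩ hoo
  have := hdesc _ z₀.1 z₀.2 rfl rfl
  exact (hle x y).trans_eq this

/-- Under a coercive drift condition, the chain forgets its initial state. -/
lemma HasDrift.tendsto_sub (h : HasDrift P f g b) (hf : ∀ x, 0 ≤ f x) (hg : ∀ x, 0 ≤ g x)
    (hffin : ∀ R : ℝ, {x | f x ≤ R}.Finite) (hgfin : ∀ R : ℝ, {x | g x ≤ R}.Finite)
    {o : S} {ℓ : S → ℕ} (hℓ : ∀ x, ∃ y ∈ (P x).support, ℓ y < ℓ x ∨ (x = o ∧ y = o))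
    (q x y : S) :
    Tendsto (fun t => (markovLaw P (PMF.pure x) t q).toReal -
      (markovLaw P (PMF.pure y) t q).toReal) atTop (𝓝 0) := by
  set u : ℕ → S → ℝ := fun t x => (markovLaw P (PMF.pure x) t q).toReal with hu
  have hu0 : ∀ t x, 0 ≤ u t x := fun t x => ENNReal.toReal_nonneg
  have hu1 : ∀ t x, u t x ≤ 1 := fun t x =>
    ENNReal.toReal_le_of_le_ofReal zero_le_one (by simpa using PMF.coe_le_one _ _)
  have hui : ∀ t (p : PMF S), Integrable (u t) p.toMeasure := fun t p =>
    p.integrable_of_bound 1 fun x _ => by rw [abs_of_nonneg (hu0 _ _)]; exact hu1 _ _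
  have husucc : ∀ t x, u (t + 1) x = ∫ x', u t x' ∂(P x).toMeasure := fun t x => by
    have h1 : markovLaw P (PMF.pure x) (t + 1) =
        (P x).bind fun y => markovLaw P (PMF.pure y) t := by
      rw [markovLaw_succ, PMF.pure_bind, ← markovLaw_bind, PMF.bind_pure]
    simp only [hu, h1]
    exact toReal_bind_apply _ _ _
  -- The average of `D t` over one independent step of both chains dominates `D (t + 1)`, by the
  -- triangle inequality.
  set D : ℕ → S → S → ℝ := fun t x y => |u t x - u t y| with hD
  have hD1 : ∀ t x y, D t x y ≤ 1 := fun t x y => by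
    rw [hD, abs_le]
    constructor <;> linarith [hu0 t x, hu0 t y, hu1 t x, hu1 t y]
  have hint : ∀ {F : S → S → ℝ}, (∀ x y, 0 ≤ F x y) → (∀ x y, F x y ≤ 1) →
      (∀ y x', Integrable (fun y' => F x' y') (P y).toMeasure) ∧
      (∀ x y, Integrable (fun x' => ∫ y', F x' y' ∂(P y).toMeasure) (P x).toMeasure) := by
    intro F hF0 hF1
    have hi : ∀ y x', Integrable (fun y' => F x' y') (P y).toMeasure := fun y x' =>
      (P y).integrable_of_bound 1 fun y' _ => by
        rw [abs_of_nonneg (hF0 _ _)]; exact hF1 _ _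
    refine ⟨hi, fun x y => (P x).integrable_of_bound 1 fun x' _ => ?_⟩
    rw [abs_of_nonneg (integral_nonneg fun y' => hF0 _ _)]
    have := integral_mono (hi y x') (integrable_const (1 : ℝ)) (fun y' => hF1 x' y')
    simpa using this
  have hDsucc : ∀ t x y, D (t + 1) x y ≤
      ∫ x', ∫ y', D t x' y' ∂(P y).toMeasure ∂(P x).toMeasure := by
    intro t x y
    have h1 : u (t + 1) x - u (t + 1) y =
        ∫ x', ∫ y', (u t x' - u t y') ∂(P y).toMeasure ∂(P x).toMeasure := by
      have : ∀ x', ∫ y', (u t x' - u t y') ∂(P y).toMeasure = u t x' - u (t + 1) y := fun x' => by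
        rw [integral_sub (integrable_const _) (hui _ _), husucc]; simp
      simp only [this]
      rw [integral_sub (hui _ _) (integrable_const _), husucc t x]; simp
    rw [hD]
    simp only
    rw [h1]
    obtain ⟨_, h2⟩ := hint (F := D t) (fun _ _ => abs_nonneg _) (hD1 t)
    refine (abs_integral_le_integral_abs).trans (integral_mono_of_nonneg
      (.of_forall fun _ => abs_nonneg _) (h2 x y) (.of_forall fun x' => ?_))
    exact abs_integral_le_integral_abs
  -- The supremum over later times is decreasing in `t`, so its limit `k` (the upper limit of `D`)
  -- exists, and it inherits the subharmonic inequality by dominated convergence.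
  set H : ℕ → S → S → ℝ := fun t x y => ⨆ s, D (t + s) x y with hH
  have hbdd : ∀ t x y, BddAbove (Set.range fun s => D (t + s) x y) := fun t x y =>
    ⟨1, by rintro _ ⟨s, rfl⟩; exact hD1 _ _ _⟩
  have hDH : ∀ t x y, D t x y ≤ H t x y := fun t x y => le_ciSup (hbdd t x y) 0
  have hH0 : ∀ t x y, 0 ≤ H t x y := fun t x y => (abs_nonneg _).trans (hDH t x y)
  have hH1 : ∀ t x y, H t x y ≤ 1 := fun t x y => ciSup_le fun s => hD1 _ _ _
  have hHanti : ∀ x y, Antitone fun t => H t x y := fun x y =>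
    antitone_nat_of_succ_le fun t => ciSup_le fun s => by
      have := le_ciSup (hbdd t x y) (1 + s)
      rwa [← add_assoc] at this
  have hHsucc : ∀ t x y, H (t + 1) x y ≤
      ∫ x', ∫ y', H t x' y' ∂(P y).toMeasure ∂(P x).toMeasure := by
    intro t x y
    refine ciSup_le fun s => ?_
    rw [add_right_comm]
    refine (hDsucc (t + s) x y).trans ?_
    obtain ⟨h1, h2⟩ := hint (F := D (t + s)) (fun _ _ => abs_nonneg _) (hD1 _)
    obtain ⟨h3, h4⟩ := hint (hH0 t) (hH1 t)
    exact integral_mono (h2 x y) (h4 x y) fun x' => integral_mono (h1 y x') (h3 y x') fun y' =>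
      le_ciSup (hbdd t x' y') s
  set k : S → S → ℝ := fun x y => ⨅ t, H t x y with hk
  have hHlim : ∀ x y, Tendsto (fun t => H t x y) atTop (𝓝 (k x y)) := fun x y =>
    tendsto_atTop_ciInf (hHanti x y) ⟨0, by rintro _ ⟨s, rfl⟩; exact hH0 _ _ _⟩
  have hk0 : ∀ x y, 0 ≤ k x y := fun x y => le_ciInf fun t => hH0 t x y
  have hk1 : ∀ x y, k x y ≤ 1 := fun x y =>
    le_of_tendsto (hHlim x y) (.of_forall fun t => hH1 t x y)
  have hko : k o o = 0 := by simp [hk, hH, hD]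
  have hsub : ∀ x y, k x y ≤ ∫ x', ∫ y', k x' y' ∂(P y).toMeasure ∂(P x).toMeasure := by
    intro x y
    refine le_of_tendsto_of_tendsto ((hHlim x y).comp (tendsto_add_atTop_nat 1)) ?_
      (.of_forall fun t => hHsucc t x y)
    refine tendsto_integral_of_dominated_convergence (fun _ => 1)
      (fun t => (measurable_of_countable _).aestronglyMeasurable) (integrable_const _)
      (fun t => .of_forall fun x' => ?_) (.of_forall fun x' => ?_)
    · rw [Real.norm_eq_abs, abs_of_nonneg (integral_nonneg fun y' => hH0 t _ _)]
      have := integral_mono ((hint (hH0 t) (hH1 t)).1 y x') (integrable_const (1 : ℝ))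
        (fun y' => hH1 t x' y')
      simpa using this
    · refine tendsto_integral_of_dominated_convergence (fun _ => 1)
        (fun t => (measurable_of_countable _).aestronglyMeasurable) (integrable_const _)
        (fun t => .of_forall fun y' => ?_) (.of_forall fun y' => hHlim x' y')
      rw [Real.norm_eq_abs, abs_of_nonneg (hH0 t _ _)]
      exact hH1 t _ _
  have hzero : k x y = 0 := le_antisymm
    (h.subharmonic_le_zero hf hg hffin hgfin hℓ hk0 hk1 hko hsub x y) (hk0 x y)
  have hlim := hHlim x y
  rw [hzero] at hlim
  exact squeeze_zero_norm (fun t => hDH t x y) hlim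

/-- A chain with a coercive drift condition that may go down to a point `o` where it may stay
converges in law to a steady state, from every initial law. -/
theorem HasDrift.exists_tendsto (h : HasDrift P f g b) (hf : ∀ x, 0 ≤ f x) (hg : ∀ x, 0 ≤ g x)
    (hb : 0 ≤ b) (hffin : ∀ R : ℝ, {x | f x ≤ R}.Finite) (hgfin : ∀ R : ℝ, {x | g x ≤ R}.Finite)
    {o : S} {ℓ : S → ℕ} (hℓ : ∀ x, ∃ y ∈ (P x).support, ℓ y < ℓ x ∨ (x = o ∧ y = o)) :
    ∃ π : PMF S, ∀ (μ : PMF S) (q : S),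
      Tendsto (fun t => markovLaw P μ t q) atTop (𝓝 (π q)) := by
  obtain ⟨π, hπ⟩ := h.exists_invariant hf hg hb hgfin o
  have hto : ∀ (μ : PMF S) (t : ℕ) (q : S), (markovLaw P μ t q).toReal =
      ∫ x, (markovLaw P (PMF.pure x) t q).toReal ∂μ.toMeasure := fun μ t q => by
    conv_lhs => rw [← PMF.bind_pure μ, markovLaw_bind]
    exact toReal_bind_apply _ _ _
  have h1 : ∀ (t : ℕ) (x q : S), ‖(markovLaw P (PMF.pure x) t q).toReal‖ ≤ 1 := fun t x q => by
    rw [Real.norm_eq_abs, abs_of_nonneg ENNReal.toReal_nonneg]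
    exact ENNReal.toReal_le_of_le_ofReal zero_le_one (by simpa using PMF.coe_le_one _ _)
  have hpt : ∀ x q, Tendsto (fun t => (markovLaw P (PMF.pure x) t q).toReal) atTop
      (𝓝 (π q).toReal) := by
    intro x q
    -- Averaging the second initial state over the invariant law turns loss of memory into
    -- convergence to that law.
    have hd : Tendsto (fun t => ∫ y, ((markovLaw P (PMF.pure x) t q).toReal -
        (markovLaw P (PMF.pure y) t q).toReal) ∂π.toMeasure) atTop (𝓝 (∫ _, 0 ∂π.toMeasure)) := by
      refine tendsto_integral_of_dominated_convergence (fun _ => 2)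
        (fun t => (measurable_of_countable _).aestronglyMeasurable) (integrable_const _)
        (fun t => .of_forall fun y => ?_)
        (.of_forall fun y => h.tendsto_sub hf hg hffin hgfin hℓ q x y)
      refine (norm_sub_le _ _).trans ?_
      linarith [h1 t x q, h1 t y q]
    have he : ∀ t, ∫ y, ((markovLaw P (PMF.pure x) t q).toReal -
        (markovLaw P (PMF.pure y) t q).toReal) ∂π.toMeasure =
        (markovLaw P (PMF.pure x) t q).toReal - (π q).toReal := fun t => by
      rw [integral_sub (integrable_const _) (π.integrable_of_bound 1 fun y _ => h1 t y q),
        ← hto, markovLaw_of_invariant hπ]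
      simp
    simp only [he, integral_zero] at hd
    simpa using hd.add_const (π q).toReal
  refine ⟨π, fun μ q => ?_⟩
  rw [← ENNReal.tendsto_toReal_iff (fun t => PMF.apply_ne_top _ _) (PMF.apply_ne_top _ _)]
  have : Tendsto (fun t => (markovLaw P μ t q).toReal) atTop
      (𝓝 (∫ _, (π q).toReal ∂μ.toMeasure)) := by
    simp only [hto μ]
    exact tendsto_integral_of_dominated_convergence (fun _ => 1)
      (fun t => (measurable_of_countable _).aestronglyMeasurable) (integrable_const _)
      (fun t => .of_forall fun y => h1 t y q) (.of_forall fun y => hpt y q)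
  simpa using this

end Ergodic

lemma PMF.abs_integral_le {S : Type*} [Countable S] [MeasurableSpace S]
    [MeasurableSingletonClass S] (p : PMF S) {f : S → ℝ} {C : ℝ}
    (h : ∀ x ∈ p.support, |f x| ≤ C) : |∫ x, f x ∂p.toMeasure| ≤ C := by
  have := norm_integral_le_of_norm_le_const (f := f) (p.ae_iff_forall_mem_support.2 h)
  simpa using this

lemma PMF.integral_affine_add {S : Type*} [MeasurableSpace S] (p : PMF S) {u v : S → ℝ}
    (hu : Integrable u p.toMeasure) (hv : Integrable v p.toMeasure) (c d : ℝ) :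
    ∫ x, (c * u x - d + v x) ∂p.toMeasure =
      c * ∫ x, u x ∂p.toMeasure - d + ∫ x, v x ∂p.toMeasure := by
  have h1 : Integrable (fun x => c * u x) p.toMeasure := hu.const_mul c
  have h2 : Integrable (fun x => c * u x - d) p.toMeasure := h1.sub (integrable_const d)
  rw [integral_add h2 hv, integral_sub h1 (integrable_const d), integral_const_mul]
  simp

/-! ### The lower bound for an arbitrary policy -/

section Optimality

variable {n : ℕ}

/-- The sum of the entries of a row. -/
def rowSum (i : Fin n) (x : SwitchMat n) : ℕ := ∑ j, x i j

/-- The queue lengths after a slot with arrivals `a` and schedule `s`. -/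
def nextQueue (x a s : SwitchMat n) : SwitchMat n := fun i j => x i j + a i j - s i j

lemma meanQueue_eq_pmfExp (π : PMF (SwitchMat n)) (i j : Fin n) :
    meanQueue π i j = pmfExp π fun q => (q i j : ℝ≥0∞) :=
  lintegral_toMeasure_eq_pmfExp _ _

lemma meanRowQueue_eq_pmfExp (π : PMF (SwitchMat n)) (i : Fin n) :
    meanRowQueue π i = pmfExp π fun q => ENNReal.ofReal (rowSum i q) := by
  rw [meanRowQueue, lintegral_toMeasure_eq_pmfExp]
  congr 1
  ext q
  rw [ENNReal.ofReal_natCast, rowSum, Nat.cast_sum]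

lemma pmfExp_queueLaw (A : PMF (SwitchMat n)) (p : SchedulingPolicy n) (init : PMF (SwitchMat n))
    (t : ℕ) (F : SwitchMat n → ℝ≥0∞) :
    pmfExp (queueLaw A p init t) F = pmfExp (historyLaw A p init t) fun h => F h.1 :=
  pmfExp_map _ _ _

lemma pmfExp_queueLaw_succ (A : PMF (SwitchMat n)) (p : SchedulingPolicy n)
    (init : PMF (SwitchMat n)) (t : ℕ) (F : SwitchMat n → ℝ≥0∞) :
    pmfExp (queueLaw A p init (t + 1)) F = pmfExp (historyLaw A p init t) fun h =>
      pmfExp (p.choose h) fun s => pmfExp A fun a => F (nextQueue h.1 a s) := by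
  rw [pmfExp_queueLaw, historyLaw, pmfExp_bind]
  simp only [switchStep, pmfExp_bind, pmfExp_map]
  rfl

lemma IsSchedule.rowSum_le_nextQueue {s : SwitchMat n} (hs : IsSchedule s) (i : Fin n)
    (x a : SwitchMat n) : rowSum i x + rowSum i a - 1 ≤ rowSum i (nextQueue x a s) := by
  have h1 : rowSum i s ≤ 1 := hs.1 i
  have h2 : rowSum i x + rowSum i a ≤ rowSum i (nextQueue x a s) + rowSum i s := by
    simp only [rowSum, nextQueue, ← Finset.sum_add_distrib]
    exact Finset.sum_le_sum fun j _ => le_tsub_add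
  omega

/-- Whatever the policy, a monotone function of the content of an input port grows at least as
for a single-server queue. -/
lemma pmfExp_le_pmfExp_queueLaw_succ (A : PMF (SwitchMat n)) (p : SchedulingPolicy n)
    (init : PMF (SwitchMat n)) (t : ℕ) (i : Fin n) {f : ℕ → ℝ≥0∞} (hf : Monotone f) :
    pmfExp (queueLaw A p init t) (fun q => pmfExp A fun a => f (rowSum i q + rowSum i a - 1)) ≤
      pmfExp (queueLaw A p init (t + 1)) fun q => f (rowSum i q) := by
  rw [pmfExp_queueLaw_succ, pmfExp_queueLaw]
  refine pmfExp_mono fun h _ => ?_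
  rw [← pmfExp_const (p.choose h) (pmfExp A fun a => f (rowSum i h.1 + rowSum i a - 1))]
  exact pmfExp_mono fun s hs => pmfExp_mono fun a _ =>
    hf ((p.feasible h s hs).rowSum_le_nextQueue i h.1 a)

/-- The means at times `t` and `t + 1` have the same limit. Boundedness of `f` is what lets weak
convergence suffice, since the policy may use the whole history and the queues need not be Markov.
-/
lemma QueueConvergesTo.integral_le {A : PMF (SwitchMat n)} {p : SchedulingPolicy n}
    {init π : PMF (SwitchMat n)} (h : QueueConvergesTo A p init π) (i : Fin n) {f : ℕ → ℝ}
    (hf : Monotone f) {B : ℝ} (h0 : ∀ k, 0 ≤ f k) (hB : ∀ k, f k ≤ B) :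
    ∫ q, ∫ a, f (rowSum i q + rowSum i a - 1) ∂A.toMeasure ∂π.toMeasure ≤
      ∫ q, f (rowSum i q) ∂π.toMeasure := by
  have habs : ∀ k, |f k| ≤ B := fun k => by rw [abs_of_nonneg (h0 k)]; exact hB k
  have hiA : ∀ q : SwitchMat n, Integrable (fun a => f (rowSum i q + rowSum i a - 1)) A.toMeasure :=
    fun q => A.integrable_of_bound B fun a _ => habs _
  have hG0 : ∀ q : SwitchMat n, 0 ≤ ∫ a, f (rowSum i q + rowSum i a - 1) ∂A.toMeasure :=
    fun q => integral_nonneg fun a => h0 _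
  have hGB : ∀ q : SwitchMat n, |∫ a, f (rowSum i q + rowSum i a - 1) ∂A.toMeasure| ≤ B :=
    fun q => by
    rw [abs_of_nonneg (hG0 q)]
    have := integral_mono (hiA q) (integrable_const B) (fun a => hB _)
    simpa using this
  have h1 := tendsto_integral_of_tendsto_pmf h (F := fun q => f (rowSum i q)) fun q => habs _
  have h2 := tendsto_integral_of_tendsto_pmf h hGB
  refine le_of_tendsto_of_tendsto h2 (h1.comp (tendsto_add_atTop_nat 1)) (.of_forall fun t => ?_)
  have h3 := pmfExp_le_pmfExp_queueLaw_succ A p init t i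
    (f := fun k => ENNReal.ofReal (f k)) (fun k l hkl => ENNReal.ofReal_le_ofReal (hf hkl))
  simp_rw [fun q => pmfExp_ofReal A (hiA q) fun _ => h0 _] at h3
  rw [pmfExp_ofReal _ (PMF.integrable_of_bound _ B fun q _ => hGB q) hG0,
    pmfExp_ofReal _ (PMF.integrable_of_bound _ B fun q _ => habs _) fun _ => h0 _] at h3
  exact (ENNReal.ofReal_le_ofReal_iff (integral_nonneg fun _ => h0 _)).1 h3

lemma IsArrivalLaw.finite_support {A : PMF (SwitchMat n)} {amax : ℕ} {lam : Fin n → Fin n → ℝ}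
    (hA : IsArrivalLaw A amax lam) : A.support.Finite :=
  (Set.Finite.pi' fun _ => Set.Finite.pi' fun _ => Set.finite_Iic amax).subset
    fun a ha i j => hA.bounded a ha i j

lemma IsArrivalLaw.integrable {A : PMF (SwitchMat n)} {amax : ℕ} {lam : Fin n → Fin n → ℝ}
    (hA : IsArrivalLaw A amax lam) (f : SwitchMat n → ℝ) : Integrable f A.toMeasure :=
  A.integrable_of_finite_support hA.finite_support f

lemma IsArrivalLaw.rowSum_le {A : PMF (SwitchMat n)} {amax : ℕ} {lam : Fin n → Fin n → ℝ}
    (hA : IsArrivalLaw A amax lam) {a : SwitchMat n} (ha : a ∈ A.support) (i : Fin n) :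
    rowSum i a ≤ n * amax := by
  refine (Finset.sum_le_sum fun j _ => hA.bounded a ha i j).trans_eq ?_
  simp

lemma IsArrivalLaw.integral_rowSum {A : PMF (SwitchMat n)} {amax : ℕ} {lam : Fin n → Fin n → ℝ}
    (hA : IsArrivalLaw A amax lam) (i : Fin n) :
    ∫ a, (rowSum i a : ℝ) ∂A.toMeasure = ∑ j, lam i j := by
  simp only [rowSum, Nat.cast_sum]
  rw [integral_finsetSum _ fun j _ => hA.integrable _]
  exact Finset.sum_congr rfl fun j _ => hA.mean i j

lemma IsArrivalLaw.integral_rowSum_sub_one_sq {A : PMF (SwitchMat n)} {amax : ℕ}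
    {lam : Fin n → Fin n → ℝ} (hA : IsArrivalLaw A amax lam) {i : Fin n} {ε : ℝ}
    (hε : ∑ j, lam i j = 1 - ε) :
    ∫ a, ((rowSum i a : ℝ) - 1) ^ 2 ∂A.toMeasure = ∑ j, arrivalVar A i j + ε ^ 2 := by
  have hm : ∀ f : SwitchMat n → ℝ, MemLp f 2 A.toMeasure := fun f => by
    rw [memLp_two_iff_integrable_sq (measurable_of_countable f).aestronglyMeasurable]
    exact hA.integrable _
  have hv : variance (fun a : SwitchMat n => (rowSum i a : ℝ)) A.toMeasure =
      ∑ j, arrivalVar A i j := by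
    have := IndepFun.variance_sum (μ := A.toMeasure) (s := Finset.univ)
      (X := fun (j : Fin n) (a : SwitchMat n) => (a i j : ℝ)) (fun j _ => hm _)
      (fun j _ k _ hjk => (hA.indep.indepFun (i := (i, j)) (j := (i, k)) (by simpa using hjk)).comp
        (measurable_of_countable (fun m : ℕ => (m : ℝ)))
        (measurable_of_countable (fun m : ℕ => (m : ℝ))))
    refine Eq.trans ?_ this
    congr 1
    ext a
    simp [rowSum]
  have h1 := variance_eq_sub (hm fun a => (rowSum i a : ℝ))
  rw [hv, hA.integral_rowSum, hε] at h1
  have h2 : ∫ a, ((rowSum i a : ℝ) - 1) ^ 2 ∂A.toMeasure =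
      ∫ a, (rowSum i a : ℝ) ^ 2 ∂A.toMeasure - 2 * ∫ a, (rowSum i a : ℝ) ∂A.toMeasure + 1 := by
    rw [← integral_const_mul, ← integral_sub (hA.integrable _) (hA.integrable _)]
    have : (1 : ℝ) = ∫ _, (1 : ℝ) ∂A.toMeasure := by simp
    conv_rhs => rw [this]
    rw [← integral_add (hA.integrable _) (hA.integrable _)]
    congr 1; ext a; ring
  rw [h2, hA.integral_rowSum, hε]
  have h3 : ∫ a, (rowSum i a : ℝ) ^ 2 ∂A.toMeasure = ∑ j, arrivalVar A i j + (1 - ε) ^ 2 := by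
    rw [h1]; simp [Pi.pow_apply]
  rw [h3]; ring

/-- In the steady state, the mean increment of a monotone function of the content of an input
port would be nonpositive with a single server. -/
lemma QueueConvergesTo.integral_sub_nonneg {A : PMF (SwitchMat n)} {p : SchedulingPolicy n}
    {init π : PMF (SwitchMat n)} (h : QueueConvergesTo A p init π)
    (i : Fin n) {f : ℕ → ℝ} (hf : Monotone f) (h0 : ∀ k, 0 ≤ f k)
    {C : SwitchMat n → ℝ} (hC : Integrable C π.toMeasure)
    (hfC : ∀ K q, ∀ a ∈ A.support,
      |f (min (rowSum i q) K) - f (min (rowSum i q + rowSum i a - 1) K)| ≤ C q) :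
    0 ≤ ∫ q, ∫ a, (f (rowSum i q) - f (rowSum i q + rowSum i a - 1)) ∂A.toMeasure
      ∂π.toMeasure := by
  have hG : ∀ K q, |∫ a, (f (min (rowSum i q) K) - f (min (rowSum i q + rowSum i a - 1) K))
      ∂A.toMeasure| ≤ C q := fun K q =>
    A.abs_integral_le fun a ha => hfC K q a ha
  have hlim : ∀ k, Tendsto (fun K => f (min k K)) atTop (𝓝 (f k)) := fun k =>
    tendsto_const_nhds.congr' <| by
      filter_upwards [eventually_ge_atTop k] with K hK
      rw [min_eq_left hK]
  -- Capping the content at `K` makes the test function bounded. The increments are dominated by `C`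
  -- uniformly in `K`, so `K → ∞` is allowed even if `f` itself has no finite mean.
  refine ge_of_tendsto (x := atTop) (f := fun K : ℕ => ∫ q, ∫ a, (f (min (rowSum i q) K) -
      f (min (rowSum i q + rowSum i a - 1) K)) ∂A.toMeasure ∂π.toMeasure) ?_
      (.of_forall fun K => ?_)
  · refine tendsto_integral_of_dominated_convergence C
      (fun K => (measurable_of_countable _).aestronglyMeasurable) hC
      (fun K => .of_forall fun q => hG K q) (.of_forall fun q => ?_)
    exact tendsto_integral_of_dominated_convergence (fun _ => C q)
      (fun K => (measurable_of_countable _).aestronglyMeasurable) (integrable_const _)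
      (fun K => A.ae_iff_forall_mem_support.2 fun a ha => hfC K q a ha)
      (.of_forall fun a => (hlim _).sub (hlim _))
  · have hfK : ∀ k, f (min k K) ≤ f K := fun k => hf (min_le_right _ _)
    have habs : ∀ k, |f (min k K)| ≤ f K := fun k => by rw [abs_of_nonneg (h0 _)]; exact hfK k
    have h1 := h.integral_le i (f := fun k => f (min k K))
      (fun k l hkl => hf (min_le_min_right K hkl)) (fun _ => h0 _) hfK
    have hiA : ∀ q : SwitchMat n, Integrable (fun a =>
        f (min (rowSum i q + rowSum i a - 1) K)) A.toMeasure :=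
      fun q => A.integrable_of_bound (f K) fun a _ => habs _
    have h2 : ∀ q : SwitchMat n, |∫ a, f (min (rowSum i q + rowSum i a - 1) K) ∂A.toMeasure| ≤
        f K := fun q => A.abs_integral_le fun a _ => habs _
    have h3 : ∀ q : SwitchMat n, ∫ a, (f (min (rowSum i q) K) -
        f (min (rowSum i q + rowSum i a - 1) K)) ∂A.toMeasure = f (min (rowSum i q) K) -
        ∫ a, f (min (rowSum i q + rowSum i a - 1) K) ∂A.toMeasure := fun q => by
      rw [integral_sub (integrable_const _) (hiA q)]; simp
    simp only [h3]
    rw [integral_sub (π.integrable_of_bound (f K) fun q _ => habs _)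
      (π.integrable_of_bound (f K) fun q _ => h2 q)]
    linarith

/-- The indicator of the event that an input port is empty and receives no arrivals. -/
noncomputable def idleInd (i : Fin n) (q a : SwitchMat n) : ℝ :=
  if rowSum i q + rowSum i a = 0 then 1 else 0

lemma abs_idleInd_le (i : Fin n) (q a : SwitchMat n) : |idleInd i q a| ≤ 1 := by
  unfold idleInd; split_ifs <;> simp

/-- Truncated subtraction differs from the real one only when content and arrivals both vanish,
where it replaces `-1` by `0`. -/
lemma cast_rowSum_add_sub_one (i : Fin n) (q a : SwitchMat n) :
    ((rowSum i q + rowSum i a - 1 : ℕ) : ℝ) = rowSum i q + rowSum i a - 1 + idleInd i q a := by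
  unfold idleInd
  split_ifs with h0
  · have h1 : ((rowSum i q + rowSum i a : ℕ) : ℝ) = 0 := by rw [h0]; simp
    push_cast at h1
    rw [h0]
    simp only [Nat.zero_sub, Nat.cast_zero]
    linarith
  · rw [Nat.cast_sub (by omega)]; push_cast; ring

lemma cast_rowSum_add_sub_one_sq (i : Fin n) (q a : SwitchMat n) :
    ((rowSum i q + rowSum i a - 1 : ℕ) : ℝ) ^ 2 =
      (rowSum i q + rowSum i a - 1) ^ 2 - idleInd i q a := by
  rw [cast_rowSum_add_sub_one]
  unfold idleInd
  split_ifs with h0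
  · have h1 : ((rowSum i q + rowSum i a : ℕ) : ℝ) = 0 := by rw [h0]; simp
    push_cast at h1
    rw [h1]; norm_num
  · ring

section Steady

variable {A : PMF (SwitchMat n)} {amax : ℕ} {lam : Fin n → Fin n → ℝ} {i : Fin n} {ε : ℝ}
  {p : SchedulingPolicy n} {init π : PMF (SwitchMat n)}

lemma IsArrivalLaw.abs_min_sub_min_le (hA : IsArrivalLaw A amax lam) (K : ℕ) (q : SwitchMat n)
    {a : SwitchMat n} (ha : a ∈ A.support) :
    |((min (rowSum i q) K : ℕ) : ℝ) - ((min (rowSum i q + rowSum i a - 1) K : ℕ) : ℝ)| ≤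
      n * amax + 1 := by
  have ha' := hA.rowSum_le ha i
  have h1 : min (rowSum i q) K ≤ min (rowSum i q + rowSum i a - 1) K + (n * amax + 1) := by
    omega
  have h2 : min (rowSum i q + rowSum i a - 1) K ≤ min (rowSum i q) K + (n * amax + 1) := by
    omega
  rify at h1 h2
  push_cast
  rw [abs_le]; constructor <;> linarith

lemma integrable_integral_idleInd (A π : PMF (SwitchMat n)) (i : Fin n) :
    Integrable (fun q => ∫ a, idleInd i q a ∂A.toMeasure) π.toMeasure :=
  π.integrable_of_bound 1 fun q _ => A.abs_integral_le fun a _ => abs_idleInd_le i q a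

/-- Rate balance: the identity as test function has mean decrease `ε` minus the idle probability
under a single server, and this is nonnegative in the steady state. -/
lemma IsArrivalLaw.integral_idleInd_le (hA : IsArrivalLaw A amax lam)
    (hε : ∑ j, lam i j = 1 - ε) (h : QueueConvergesTo A p init π) :
    ∫ q, ∫ a, idleInd i q a ∂A.toMeasure ∂π.toMeasure ≤ ε := by
  have h1 := h.integral_sub_nonneg i (f := fun k => (k : ℝ)) Nat.mono_cast
    (fun k => Nat.cast_nonneg k) (C := fun _ => n * amax + 1) (integrable_const _)
    fun K q a ha => hA.abs_min_sub_min_le K q ha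
  have h2 : ∀ q, ∫ a, ((rowSum i q : ℝ) - ((rowSum i q + rowSum i a - 1 : ℕ) : ℝ))
      ∂A.toMeasure = ε - ∫ a, idleInd i q a ∂A.toMeasure := fun q => by
    have : ∀ a, (rowSum i q : ℝ) - ((rowSum i q + rowSum i a - 1 : ℕ) : ℝ) =
        (1 - (rowSum i a : ℝ)) - idleInd i q a := fun a => by
      rw [cast_rowSum_add_sub_one]; ring
    simp only [this]
    rw [integral_sub (hA.integrable _) (hA.integrable _),
      integral_sub (hA.integrable _) (hA.integrable _), hA.integral_rowSum, hε]
    simp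
  simp only [h2] at h1
  rw [integral_sub (integrable_const _) (integrable_integral_idleInd A π i)] at h1
  simp only [integral_const, probReal_univ, one_smul] at h1
  linarith

lemma IsArrivalLaw.integral_rowSum_sq_sub (hA : IsArrivalLaw A amax lam)
    (hε : ∑ j, lam i j = 1 - ε) (q : SwitchMat n) :
    ∫ a, ((rowSum i q : ℝ) ^ 2 - ((rowSum i q + rowSum i a - 1 : ℕ) : ℝ) ^ 2) ∂A.toMeasure =
      2 * ε * rowSum i q - (∑ j, arrivalVar A i j + ε ^ 2) + ∫ a, idleInd i q a ∂A.toMeasure := by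
  have : ∀ a, (rowSum i q : ℝ) ^ 2 - ((rowSum i q + rowSum i a - 1 : ℕ) : ℝ) ^ 2 =
      2 * rowSum i q * (1 - (rowSum i a : ℝ)) - ((rowSum i a : ℝ) - 1) ^ 2 + idleInd i q a :=
    fun a => by rw [cast_rowSum_add_sub_one_sq]; ring
  simp only [this]
  rw [integral_add (hA.integrable _) (hA.integrable _),
    integral_sub (hA.integrable _) (hA.integrable _), integral_const_mul,
    integral_sub (hA.integrable _) (hA.integrable _), hA.integral_rowSum, hε,
    hA.integral_rowSum_sub_one_sq hε]
  simp only [integral_const, probReal_univ, one_smul]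
  ring

/-- A first moment suffices for the quadratic test function: its increments are linear in the
content, as arrivals are bounded. -/
lemma IsArrivalLaw.integral_rowSum_sq_sub_nonneg (hA : IsArrivalLaw A amax lam)
    (h : QueueConvergesTo A p init π) (hri : Integrable (fun q => (rowSum i q : ℝ)) π.toMeasure) :
    0 ≤ ∫ q, ∫ a, ((rowSum i q : ℝ) ^ 2 - ((rowSum i q + rowSum i a - 1 : ℕ) : ℝ) ^ 2)
      ∂A.toMeasure ∂π.toMeasure := by
  set D : ℝ := n * amax + 1 with hD
  have hD0 : 0 ≤ D := by positivity
  refine h.integral_sub_nonneg i (f := fun k => (k : ℝ) ^ 2)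
    (fun k l hkl => by simp only; gcongr)
    (fun k => by positivity) (C := fun q => D * (2 * rowSum i q + D))
    (((hri.const_mul 2).add (integrable_const D)).const_mul D)
    (fun K q a ha => ?_)
  have h2 := hA.abs_min_sub_min_le (i := i) K q ha
  rw [sq_sub_sq, abs_mul, mul_comm]
  refine mul_le_mul h2 ?_ (abs_nonneg _) hD0
  have h3 : ((min (rowSum i q) K : ℕ) : ℝ) ≤ rowSum i q := by exact_mod_cast min_le_left _ _
  have h4 := abs_le.1 h2
  rw [abs_of_nonneg (by positivity)]
  linarith

/-- The universal lower bound for the mean content of an input port of arrival rate `1 - ε`. -/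
theorem IsArrivalLaw.le_mul_meanRowQueue (hA : IsArrivalLaw A amax lam) (hε0 : 0 < ε)
    (hε : ∑ j, lam i j = 1 - ε) (h : QueueConvergesTo A p init π) :
    ENNReal.ofReal ((∑ j, arrivalVar A i j + ε ^ 2 - ε) / 2) ≤
      ENNReal.ofReal ε * meanRowQueue π i := by
  by_cases htop : meanRowQueue π i = ∞
  · rw [htop, ENNReal.mul_top (by simpa using hε0)]
    exact le_top
  rw [meanRowQueue_eq_pmfExp] at htop ⊢
  have hr0 : ∀ q : SwitchMat n, (0 : ℝ) ≤ rowSum i q := fun q => Nat.cast_nonneg _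
  have hri : Integrable (fun q => (rowSum i q : ℝ)) π.toMeasure :=
    integrable_of_pmfExp_le π hr0 (ENNReal.ofReal_toReal htop).ge
  rw [pmfExp_ofReal π hri hr0, ← ENNReal.ofReal_mul hε0.le]
  refine ENNReal.ofReal_le_ofReal ?_
  have e1 := hA.integral_idleInd_le hε h
  have h1 := hA.integral_rowSum_sq_sub_nonneg h hri
  simp only [hA.integral_rowSum_sq_sub hε] at h1
  rw [PMF.integral_affine_add π hri (integrable_integral_idleInd A π i)] at h1
  linarith

end Steady

end Optimality

/-! ### The capacity region and the directions of perturbation -/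

section Geometry

variable {n : ℕ}

/-- The Euclidean inner product of matrices. -/
def matInner (x y : Fin n → Fin n → ℝ) : ℝ := ∑ i, ∑ j, x i j * y i j

/-- The orthogonal projection of a matrix along the indicator matrix of the row `z`. -/
noncomputable def matPerp (z : Fin n) (x : Fin n → Fin n → ℝ) : Fin n → Fin n → ℝ :=
  fun i j => x i j - if i = z then (∑ k, x z k) / n else 0

lemma matInner_comm (x y : Fin n → Fin n → ℝ) : matInner x y = matInner y x := by
  simp only [matInner, mul_comm]

lemma matInner_add_right (x y y' : Fin n → Fin n → ℝ) :
    matInner x (y + y') = matInner x y + matInner x y' := by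
  simp [matInner, mul_add, Finset.sum_add_distrib]

lemma matInner_smul_right (c : ℝ) (x y : Fin n → Fin n → ℝ) :
    matInner x (c • y) = c * matInner x y := by
  simp only [matInner, Pi.smul_apply, smul_eq_mul, Finset.mul_sum]
  exact Finset.sum_congr rfl fun i _ => Finset.sum_congr rfl fun j _ => by ring

lemma matInner_sub_right (x y y' : Fin n → Fin n → ℝ) :
    matInner x (y - y') = matInner x y - matInner x y' := by
  simp [matInner, mul_sub, Finset.sum_sub_distrib]

lemma matInner_add_self (x y : Fin n → Fin n → ℝ) :
    matInner (x + y) (x + y) = matInner x x + 2 * matInner x y + matInner y y := by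
  rw [matInner_add_right, matInner_comm _ x, matInner_comm _ y, matInner_add_right,
    matInner_add_right, matInner_comm y x]
  ring

lemma matInner_self_nonneg (x : Fin n → Fin n → ℝ) : 0 ≤ matInner x x :=
  Finset.sum_nonneg fun _ _ => Finset.sum_nonneg fun _ _ => mul_self_nonneg _

lemma sq_le_matInner_self (x : Fin n → Fin n → ℝ) (i j : Fin n) : x i j ^ 2 ≤ matInner x x := by
  rw [sq]
  refine (Finset.single_le_sum (f := fun j => x i j * x i j) (fun _ _ => mul_self_nonneg _)
    (Finset.mem_univ j)).trans ?_
  exact Finset.single_le_sum (f := fun i => ∑ j, x i j * x i j)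
    (fun _ _ => Finset.sum_nonneg fun _ _ => mul_self_nonneg _) (Finset.mem_univ i)

lemma abs_le_sqrt_matInner (x : Fin n → Fin n → ℝ) (i j : Fin n) :
    |x i j| ≤ √(matInner x x) :=
  Real.abs_le_sqrt (sq_le_matInner_self x i j)

lemma abs_matInner_le {x y : Fin n → Fin n → ℝ} {B C : ℝ} (hx : ∀ i j, |x i j| ≤ B)
    (hy : ∀ i j, |y i j| ≤ C) : |matInner x y| ≤ n ^ 2 * (B * C) := by
  have h : ∀ i j, |x i j * y i j| ≤ B * C := fun i j => by
    rw [abs_mul]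
    exact mul_le_mul (hx i j) (hy i j) (abs_nonneg _) ((abs_nonneg _).trans (hx i j))
  refine (Finset.abs_sum_le_sum_abs _ _).trans ?_
  refine (Finset.sum_le_sum fun i _ => (Finset.abs_sum_le_sum_abs _ _).trans
    (Finset.sum_le_sum fun j _ => h i j)).trans_eq ?_
  simp only [Finset.sum_const, Finset.card_univ, Fintype.card_fin, nsmul_eq_mul]
  ring

lemma matPerp_add (z : Fin n) (x y : Fin n → Fin n → ℝ) :
    matPerp z (x + y) = matPerp z x + matPerp z y := by
  ext i j
  simp only [matPerp, Pi.add_apply, Finset.sum_add_distrib]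
  split_ifs <;> ring

lemma sum_matPerp (z : Fin n) (x : Fin n → Fin n → ℝ) : ∑ j, matPerp z x z j = 0 := by
  have hn : (n : ℝ) ≠ 0 := by
    have := z.pos
    positivity
  simp only [matPerp, if_true, Finset.sum_sub_distrib, Finset.sum_const, Finset.card_univ,
    Fintype.card_fin, nsmul_eq_mul]
  field_simp
  ring

lemma matInner_matPerp_right (z : Fin n) (x y : Fin n → Fin n → ℝ) :
    matInner x (matPerp z y) = matInner x y - (∑ j, x z j) * ((∑ k, y z k) / n) := by
  simp only [matInner, matPerp, mul_sub, Finset.sum_sub_distrib]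
  congr 1
  rw [Finset.sum_mul, Finset.sum_eq_single z]
  · simp
  · intro i _ hi; simp [hi]
  · simp

lemma matInner_matPerp_matPerp (z : Fin n) (x y : Fin n → Fin n → ℝ) :
    matInner (matPerp z x) (matPerp z y) = matInner (matPerp z x) y := by
  rw [matInner_matPerp_right, sum_matPerp]; ring

lemma matInner_matPerp_self_eq (z : Fin n) (x : Fin n → Fin n → ℝ) :
    matInner x (matPerp z x) = matInner (matPerp z x) (matPerp z x) := by
  rw [matInner_matPerp_matPerp, matInner_comm]

lemma matInner_matPerp_left_of_sum_eq_zero (z : Fin n) (x : Fin n → Fin n → ℝ)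
    {y : Fin n → Fin n → ℝ} (hy : ∑ j, y z j = 0) :
    matInner (matPerp z x) y = matInner x y := by
  rw [matInner_comm, matInner_matPerp_right, hy, matInner_comm]; ring

lemma matInner_matPerp_self_le (z : Fin n) (x : Fin n → Fin n → ℝ) :
    matInner (matPerp z x) (matPerp z x) ≤ matInner x x := by
  rw [← matInner_matPerp_self_eq, matInner_matPerp_right]
  have : 0 ≤ (∑ j, x z j) * ((∑ k, x z k) / n) := by
    rw [← mul_div_assoc]
    exact div_nonneg (mul_self_nonneg _) (Nat.cast_nonneg _)
  linarith

/-- The matrix of real numbers of a matrix of natural numbers. -/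
def castMat (x : SwitchMat n) : Fin n → Fin n → ℝ := fun i j => x i j

lemma matInner_castMat (x s : SwitchMat n) :
    matInner (castMat x) (castMat s) = (scheduleWeight x s : ℝ) := by
  simp [matInner, castMat, scheduleWeight]

/-- Maximal schedules of maximal weight. -/
def IsMaxWeightSchedule (x s : SwitchMat n) : Prop :=
  IsMaximalSchedule s ∧ ∀ s', IsSchedule s' → scheduleWeight x s' ≤ scheduleWeight x s

/-- Every point of the capacity region is dominated by a doubly stochastic matrix. -/
lemma exists_doublyStochastic_ge {y : Fin n → Fin n → ℝ} (hy : y ∈ capacityRegion n) :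
    ∃ M : Matrix (Fin n) (Fin n) ℝ, M ∈ doublyStochastic ℝ (Fin n) ∧ ∀ i j, y i j ≤ M i j := by
  obtain ⟨h0, hr, hc⟩ := hy
  -- The row deficits `ρ` and column deficits `κ` have the same total `τ`, so adding the rank-one
  -- matrix `ρ i * κ j / τ` fills all of them.
  set ρ : Fin n → ℝ := fun i => 1 - ∑ j, y i j with hρ
  set κ : Fin n → ℝ := fun j => 1 - ∑ i, y i j with hκ
  have hρ0 : ∀ i, 0 ≤ ρ i := fun i => sub_nonneg.2 (hr i)
  have hκ0 : ∀ i, 0 ≤ κ i := fun i => sub_nonneg.2 (hc i)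
  have hsum : ∑ i, ρ i = ∑ j, κ j := by
    simp only [hρ, hκ, Finset.sum_sub_distrib]
    rw [Finset.sum_comm]
  set τ := ∑ i, ρ i with hτ
  have hτ0 : 0 ≤ τ := Finset.sum_nonneg fun i _ => hρ0 i
  -- If `τ = 0`, all deficits vanish and division by zero returns the required `0`.
  have hcancel : ∀ c, 0 ≤ c → c ≤ τ → c * τ / τ = c := fun c hc hcτ => by
    by_cases h : τ = 0
    · rw [h] at hcτ ⊢; simp; linarith
    · field_simp
  have hadd : ∀ i j, y i j ≤ y i j + ρ i * κ j / τ := fun i j =>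
    le_add_of_nonneg_right (div_nonneg (mul_nonneg (hρ0 i) (hκ0 j)) hτ0)
  refine ⟨Matrix.of fun i j => y i j + ρ i * κ j / τ, ?_, hadd⟩
  rw [mem_doublyStochastic_iff_sum]
  simp only [Matrix.of_apply]
  refine ⟨fun i j => (h0 i j).trans (hadd i j), fun i => ?_, fun j => ?_⟩
  · rw [Finset.sum_add_distrib, ← Finset.sum_div, ← Finset.mul_sum, ← hsum,
      hcancel _ (hρ0 i) (Finset.single_le_sum (fun i _ => hρ0 i) (Finset.mem_univ i))]
    simp [hρ]
  · rw [Finset.sum_add_distrib, ← Finset.sum_div, ← Finset.sum_mul, ← hτ, mul_comm,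
      hcancel _ (hκ0 j) (hsum ▸ Finset.single_le_sum (fun i _ => hκ0 i) (Finset.mem_univ j))]
    simp [hκ]

/-- MaxWeight maximizes the weight over the whole capacity region. -/
lemma IsMaxWeightSchedule.matInner_le {x s : SwitchMat n} (hs : IsMaxWeightSchedule x s)
    {y : Fin n → Fin n → ℝ} (hy : y ∈ capacityRegion n) :
    matInner (castMat x) y ≤ matInner (castMat x) (castMat s) := by
  obtain ⟨M, hM, hyM⟩ := exists_doublyStochastic_ge hy
  -- Birkhoff's theorem: the weight is linear, so it is enough to compare with permutation matrices,
  -- which are schedules.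
  obtain ⟨w, hw0, hw1, hwM⟩ := exists_eq_sum_perm_of_mem_doublyStochastic hM
  have h1 : matInner (castMat x) y ≤ matInner (castMat x) M :=
    Finset.sum_le_sum fun i _ => Finset.sum_le_sum fun j _ =>
      mul_le_mul_of_nonneg_left (hyM i j) (Nat.cast_nonneg _)
  have h2 : ∀ σ : Equiv.Perm (Fin n), matInner (castMat x) (σ.permMatrix ℝ) ≤
      matInner (castMat x) (castMat s) := fun σ => by
    set s' : SwitchMat n := fun i j => if σ i = j then 1 else 0 with hs'
    have hsched : IsSchedule s' := by
      refine ⟨fun i => by simp [hs'], fun j => ?_⟩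
      simp [hs', ← Equiv.eq_symm_apply]
    have : (σ.permMatrix ℝ : Fin n → Fin n → ℝ) = castMat s' := by
      ext i j
      simp [castMat, hs', Equiv.Perm.permMatrix, PEquiv.toMatrix_apply, Equiv.toPEquiv_apply, eq_comm]
    rw [this, matInner_castMat, matInner_castMat]
    exact_mod_cast hs.2 s' hsched
  have h3 : matInner (castMat x) M = ∑ σ : Equiv.Perm (Fin n),
      w σ * matInner (castMat x) (σ.permMatrix ℝ) := by
    have hM' : ∀ i j, M i j = ∑ σ : Equiv.Perm (Fin n), w σ * σ.permMatrix ℝ i j := fun i j => by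
      rw [← hwM]; simp only [Matrix.sum_apply, Matrix.smul_apply, smul_eq_mul]
    simp only [matInner, hM', Finset.mul_sum]
    rw [Finset.sum_comm (s := (Finset.univ : Finset (Equiv.Perm (Fin n))))]
    refine Finset.sum_congr rfl fun i _ => ?_
    rw [Finset.sum_comm]
    exact Finset.sum_congr rfl fun σ _ => Finset.sum_congr rfl fun j _ => by ring
  calc _ ≤ _ := h1
    _ = _ := h3
    _ ≤ ∑ σ : Equiv.Perm (Fin n), w σ * matInner (castMat x) (castMat s) :=
      Finset.sum_le_sum fun σ _ => mul_le_mul_of_nonneg_left (h2 σ) (hw0 σ)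
    _ = _ := by rw [← Finset.sum_mul, hw1, one_mul]

/-- An inequality that is strict somewhere on a set is strict on its relative interior. -/
lemma lt_of_mem_intrinsicInterior {E : Type*} [NormedAddCommGroup E] [NormedSpace ℝ E] {s : Set E}
    {x c : E} (hx : x ∈ intrinsicInterior ℝ s) (hc : c ∈ s) (φ : E →ₗ[ℝ] ℝ)
    (hφ : ∀ y ∈ s, φ y ≤ 1) (hφc : φ c < 1) : φ x < 1 := by
  obtain ⟨y, hy, rfl⟩ := mem_intrinsicInterior.1 hx
  set c' : affineSpan ℝ s := ⟨c, subset_affineSpan ℝ s hc⟩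
  have hmem : ∀ t : ℝ, AffineMap.lineMap (y : E) c t ∈ affineSpan ℝ s := fun t =>
    AffineMap.lineMap_mem t y.2 c'.2
  have hcont : Continuous fun t : ℝ => (⟨AffineMap.lineMap (y : E) c t, hmem t⟩ : affineSpan ℝ s) :=
    Continuous.subtype_mk AffineMap.lineMap_continuous _
  have h0 : (⟨AffineMap.lineMap (y : E) c (0 : ℝ), hmem 0⟩ : affineSpan ℝ s) = y := by
    ext; simp
  have hev : ∀ᶠ t in 𝓝 (0 : ℝ), (AffineMap.lineMap (y : E) c t) ∈ s := by
    have : Tendsto (fun t : ℝ => (⟨AffineMap.lineMap (y : E) c t, hmem t⟩ : affineSpan ℝ s))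
        (𝓝 0) (𝓝 y) := by
      have := hcont.tendsto 0
      rwa [h0] at this
    filter_upwards [this.eventually (isOpen_interior.mem_nhds hy)] with t ht
    exact interior_subset (s := Subtype.val ⁻¹' s) ht
  -- The segment from `c` to the interior point extends a little beyond it inside `s`. Equality at
  -- the interior point would make `φ` exceed `1` there.
  obtain ⟨t, ht, htneg⟩ : ∃ t : ℝ, AffineMap.lineMap (y : E) c t ∈ s ∧ t < 0 :=
    ((hev.filter_mono nhdsWithin_le_nhds).and
      (self_mem_nhdsWithin (s := Set.Iio (0 : ℝ)))).exists
  have h1 := hφ _ ht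
  rw [AffineMap.lineMap_apply_module, map_add, map_smul, map_smul, smul_eq_mul, smul_eq_mul] at h1
  nlinarith

/-- A point of the relative interior of the face, with positive entries, may be perturbed in all
directions that do not change the sum of the first row. -/
lemma exists_perturbation_mem_capacityRegion (hn : 1 < n) {ν : Fin n → Fin n → ℝ}
    (hν : ν ∈ intrinsicInterior ℝ (saturatedFace n 1 0)) (hν_pos : ∀ i j, 0 < ν i j) :
    ∃ δ : ℝ, 0 < δ ∧ ∀ d : Fin n → Fin n → ℝ, (∀ i j, |d i j| ≤ 1) →
      ∑ j, d ⟨0, Nat.zero_lt_of_lt hn⟩ j = 0 → ν + δ • d ∈ capacityRegion n := by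
  set z : Fin n := ⟨0, Nat.zero_lt_of_lt hn⟩ with hz
  have hn0 : (0 : ℝ) < n := by exact_mod_cast Nat.zero_lt_of_lt hn
  have hn1 : (1 : ℝ) / n < 1 := by
    rw [div_lt_one hn0]; exact_mod_cast hn
  have hzi : ∀ i : Fin n, i.val < 1 ↔ i = z := fun i => by
    rw [hz, Fin.ext_iff]; simp
  -- The uniform distribution on the saturated row lies in the face and leaves every other row and,
  -- as `1 < n`, every column strictly unsaturated. Hence these constraints are slack at `ν`.
  set c : Fin n → Fin n → ℝ := fun i _ => if i = z then 1 / n else 0 with hc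
  have hcrow : ∀ i, ∑ j, c i j = if i = z then 1 else 0 := fun i => by
    simp only [hc]
    split_ifs
    · simp [hn0.ne']
    · simp
  have hccol : ∀ j, ∑ i, c i j = 1 / n := fun j => by simp [hc]
  have hcmem : c ∈ saturatedFace n 1 0 := by
    refine ⟨⟨fun i j => ?_, fun i => ?_, fun j => ?_⟩, fun i hi => ?_, fun j hj => ?_⟩
    · simp only [hc]; split_ifs <;> positivity
    · rw [hcrow]; split_ifs <;> simp
    · rw [hccol j]; exact hn1.le
    · rw [hcrow, if_pos ((hzi i).1 hi)]
    · omega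
  have hmem := intrinsicInterior_subset hν
  have hrow : ∀ i, i ≠ z → ∑ j, ν i j < 1 := fun i hi => by
    have := lt_of_mem_intrinsicInterior hν hcmem
      (∑ j, (LinearMap.proj j : (Fin n → ℝ) →ₗ[ℝ] ℝ) ∘ₗ LinearMap.proj i)
      (fun y hy => by simpa [LinearMap.sum_apply] using hy.1.2.1 i)
      (by simp [LinearMap.sum_apply, hcrow, hi])
    simpa [LinearMap.sum_apply] using this
  have hcol : ∀ j, ∑ i, ν i j < 1 := fun j => by
    have := lt_of_mem_intrinsicInterior hν hcmem
      (∑ i, (LinearMap.proj j : (Fin n → ℝ) →ₗ[ℝ] ℝ) ∘ₗ LinearMap.proj i)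
      (fun y hy => by simpa [LinearMap.sum_apply] using hy.1.2.2 j)
      (by simpa [LinearMap.sum_apply, hccol] using hn1)
    simpa [LinearMap.sum_apply] using this
  have hsmall : ∀ η : ℝ, 0 < η → ∀ᶠ δ in 𝓝[>] (0 : ℝ), δ * n < η := fun η hη => by
    have : Tendsto (fun δ : ℝ => δ * n) (𝓝[>] 0) (𝓝 (0 * n)) :=
      (tendsto_id.mono_left nhdsWithin_le_nhds).mul_const _
    rw [zero_mul] at this
    exact this.eventually (gt_mem_nhds hη)
  have e1 : ∀ᶠ δ in 𝓝[>] (0 : ℝ), ∀ i j, δ * n < ν i j :=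
    eventually_all.2 fun i => eventually_all.2 fun j => hsmall _ (hν_pos i j)
  have e2 : ∀ᶠ δ in 𝓝[>] (0 : ℝ), ∀ i, i ≠ z → δ * n < 1 - ∑ j, ν i j :=
    eventually_all.2 fun i => by
      by_cases hi : i = z
      · simp [hi]
      · filter_upwards [hsmall _ (sub_pos.2 (hrow i hi))] with δ hδ _ using hδ
  have e3 : ∀ᶠ δ in 𝓝[>] (0 : ℝ), ∀ j, δ * n < 1 - ∑ i, ν i j :=
    eventually_all.2 fun j => hsmall _ (sub_pos.2 (hcol j))
  obtain ⟨δ, ⟨⟨h1, h2⟩, h3⟩, hδ⟩ :=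
    (((e1.and e2).and e3).and (self_mem_nhdsWithin (s := Set.Ioi (0 : ℝ)))).exists
  have hδ0 : 0 < δ := hδ
  refine ⟨δ, hδ0, fun d hd hdz => ⟨fun i j => ?_, fun i => ?_, fun j => ?_⟩⟩
  · have := (abs_le.1 (hd i j)).1
    have := h1 i j
    have hn1' : (1 : ℝ) ≤ n := by exact_mod_cast hn.le
    simp only [Pi.add_apply, Pi.smul_apply, smul_eq_mul]
    nlinarith
  · simp only [Pi.add_apply, Pi.smul_apply, smul_eq_mul, Finset.sum_add_distrib, ← Finset.mul_sum]
    by_cases hi : i = z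
    · rw [hi, hdz, mul_zero, add_zero]
      exact hmem.1.2.1 z
    · have hle : ∑ j, d i j ≤ n := by
        refine (Finset.sum_le_sum fun j _ => (abs_le.1 (hd i j)).2).trans_eq ?_
        simp
      have := h2 i hi
      nlinarith
  · simp only [Pi.add_apply, Pi.smul_apply, smul_eq_mul, Finset.sum_add_distrib, ← Finset.mul_sum]
    have hle : ∑ i, d i j ≤ n := by
      refine (Finset.sum_le_sum fun i _ => (abs_le.1 (hd i j)).2).trans_eq ?_
      simp
    have := h3 j
    nlinarith

end Geometry

/-! ### Increments of the queues for a fixed schedule and fixed arrivals -/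

section Drift

variable {n : ℕ}

/-- The unused service at each queue in a slot. -/
def unusedService (x a s : SwitchMat n) : Fin n → Fin n → ℝ :=
  castMat (nextQueue x a s) - (castMat x + (castMat a - castMat s))

lemma castMat_nextQueue (x a s : SwitchMat n) : castMat (nextQueue x a s) =
    castMat x + ((castMat a - castMat s) + unusedService x a s) := by
  unfold unusedService; abel

lemma IsMaximalSchedule.le_one {s : SwitchMat n} (hs : IsMaximalSchedule s) (i j : Fin n) :
    s i j ≤ 1 :=
  (Finset.single_le_sum (fun _ _ => Nat.zero_le _) (Finset.mem_univ j)).trans_eq (hs.1 i)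

section Pointwise

variable {x a s : SwitchMat n}

/-- Service is wasted only at a queue with `x = a = 0` and `s = 1`, which is empty before and after
the slot; hence both products vanish. -/
lemma IsMaximalSchedule.unusedService_spec (hs : IsMaximalSchedule s)
    (x a : SwitchMat n) (i j : Fin n) :
    0 ≤ unusedService x a s i j ∧ unusedService x a s i j ≤ s i j ∧
      castMat x i j * unusedService x a s i j = 0 ∧
      castMat (nextQueue x a s) i j * unusedService x a s i j = 0 := by
  have h1 := hs.le_one i j
  simp only [unusedService, castMat, nextQueue, Pi.sub_apply, Pi.add_apply]
  rcases le_or_gt (s i j) (x i j + a i j) with h | h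
  · have : ((x i j + a i j - s i j : ℕ) : ℝ) = x i j + a i j - s i j := by
      rw [Nat.cast_sub h]; push_cast; ring
    rw [this]
    ring_nf
    simp
  · have hx : x i j = 0 := by omega
    have ha : a i j = 0 := by omega
    have hs1 : s i j = 1 := by omega
    simp [hx, ha, hs1]

lemma IsMaximalSchedule.abs_sub_add_unusedService_le (hs : IsMaximalSchedule s) {amax : ℕ}
    (ha : ∀ i j, a i j ≤ amax)
    (i j : Fin n) :
    |((castMat a - castMat s) + unusedService x a s) i j| ≤ amax + 1 := by
  obtain ⟨h1, h2, -, -⟩ := hs.unusedService_spec x a i j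
  have h3 : (s i j : ℝ) ≤ 1 := by exact_mod_cast hs.le_one i j
  have h4 : (a i j : ℝ) ≤ amax := by exact_mod_cast ha i j
  have h5 : (0 : ℝ) ≤ a i j := Nat.cast_nonneg _
  simp only [Pi.add_apply, Pi.sub_apply, castMat]
  rw [abs_le]; constructor <;> linarith

/-- Where service is wasted the queue is empty, so the projected entry is minus the row average or
zero. Thus wasted service can be dropped from upper bounds. -/
lemma IsMaximalSchedule.matInner_matPerp_unusedService_le (hs : IsMaximalSchedule s) (z : Fin n) :
    matInner (matPerp z (castMat x)) (unusedService x a s) ≤ 0 := by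
  refine Finset.sum_nonpos fun i _ => Finset.sum_nonpos fun j _ => ?_
  obtain ⟨h1, -, h3, -⟩ := hs.unusedService_spec x a i j
  have h4 : 0 ≤ (if i = z then (∑ k, castMat x z k) / n else 0 : ℝ) := by
    split_ifs
    · exact div_nonneg (Finset.sum_nonneg fun k _ => Nat.cast_nonneg _) (Nat.cast_nonneg _)
    · exact le_rfl
  rw [matPerp, sub_mul, h3]
  nlinarith

lemma IsMaximalSchedule.matInner_nextQueue_le (hs : IsMaximalSchedule s) {amax : ℕ}
    (ha : ∀ i j, a i j ≤ amax) :
    matInner (castMat (nextQueue x a s)) (castMat (nextQueue x a s)) ≤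
      matInner (castMat x) (castMat x) + 2 * matInner (castMat x) (castMat a - castMat s) +
        n ^ 2 * (amax + 1) ^ 2 := by
  have h := hs.abs_sub_add_unusedService_le (x := x) ha
  have h1 := (abs_le.1 (abs_matInner_le h h)).2
  have h2 : matInner (castMat x) (unusedService x a s) = 0 :=
    Finset.sum_eq_zero fun i _ => Finset.sum_eq_zero fun j _ =>
      (hs.unusedService_spec x a i j).2.2.1
  rw [castMat_nextQueue, matInner_add_self, matInner_add_right _ _ (unusedService x a s), h2]
  linarith

/-- The squared distance from the line of state space collapse. -/
noncomputable def perpSq (z : Fin n) (x : SwitchMat n) : ℝ :=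
  matInner (matPerp z (castMat x)) (matPerp z (castMat x))

lemma perpSq_nonneg (z : Fin n) (x : SwitchMat n) : 0 ≤ perpSq z x := matInner_self_nonneg _

/-- The one-sided bound keeps the inner product that MaxWeight makes negative; the two-sided one
controls the square of the increment in the fourth-power drift. -/
lemma IsMaximalSchedule.perpSq_nextQueue (hs : IsMaximalSchedule s) {amax : ℕ}
    (ha : ∀ i j, a i j ≤ amax) (z : Fin n) :
    perpSq z (nextQueue x a s) ≤ perpSq z x +
      2 * matInner (matPerp z (castMat x)) (castMat a - castMat s) + n ^ 2 * (amax + 1) ^ 2 ∧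
    |perpSq z (nextQueue x a s) - perpSq z x| ≤
      n ^ 2 * (amax + 1) * (2 * √(perpSq z x) + (amax + 1)) := by
  have h := hs.abs_sub_add_unusedService_le (x := x) ha
  have h1 := (abs_le.1 (abs_matInner_le h h)).2
  set Δ := (castMat a - castMat s) + unusedService x a s with hΔ
  have h2 := (matInner_matPerp_self_le z Δ).trans h1
  have h3 := matInner_self_nonneg (matPerp z Δ)
  have h4 : perpSq z (nextQueue x a s) = perpSq z x + 2 * matInner (matPerp z (castMat x)) Δ +
      matInner (matPerp z Δ) (matPerp z Δ) := by
    rw [perpSq, castMat_nextQueue, ← hΔ, matPerp_add, matInner_add_self,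
      matInner_matPerp_matPerp z (castMat x) Δ]
    rfl
  have h5 : matInner (matPerp z (castMat x)) Δ ≤
      matInner (matPerp z (castMat x)) (castMat a - castMat s) := by
    rw [hΔ, matInner_add_right]
    linarith [hs.matInner_matPerp_unusedService_le (x := x) (a := a) z]
  have h6 := abs_le.1
    (abs_matInner_le (fun i j => abs_le_sqrt_matInner (matPerp z (castMat x)) i j) h)
  change _ ∧ matInner (matPerp z (castMat x)) Δ ≤ n ^ 2 * (√(perpSq z x) * (amax + 1)) at h6
  have h7 : -(n ^ 2 * (√(perpSq z x) * (amax + 1))) ≤ matInner (matPerp z (castMat x)) Δ := h6.1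
  refine ⟨by rw [h4]; linarith, ?_⟩
  rw [h4, abs_le]
  constructor <;> nlinarith [h6.2, h7, h2, h3]

/-- The factor of `L` is the wasted service `U` of the row, written through the contents so that a
linear correction of the Lyapunov function can cancel it. At a wasted cell the new queue is zero, so
the new row average there is at most the distance `V` from the line. -/
lemma IsMaximalSchedule.rowSum_nextQueue_sq_le (hs : IsMaximalSchedule s) (z : Fin n) {L : ℝ} (hL : 0 < L) :
    (rowSum z (nextQueue x a s) : ℝ) ^ 2 ≤ ((rowSum z x : ℝ) + (rowSum z a - 1)) ^ 2 +
      2 * n * (L * ((rowSum z (nextQueue x a s) : ℝ) - rowSum z x - rowSum z a + 1) +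
        perpSq z (nextQueue x a s) / L) := by
  have hn : (0 : ℝ) < n := by exact_mod_cast z.pos
  set U := ∑ j, unusedService x a s z j with hU
  have hspec := hs.unusedService_spec x a z
  have hU0 : 0 ≤ U := Finset.sum_nonneg fun j _ => (hspec j).1
  have hs1 : ∑ j, (s z j : ℝ) = 1 := by exact_mod_cast hs.1 z
  have hU1 : U ≤ 1 := by
    rw [← hs1]; exact Finset.sum_le_sum fun j _ => (hspec j).2.1
  have hr : (rowSum z (nextQueue x a s) : ℝ) = rowSum z x + (rowSum z a - 1) + U := by
    rw [hU, ← hs1]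
    simp only [rowSum, Nat.cast_sum, ← Finset.sum_add_distrib, ← Finset.sum_sub_distrib]
    refine Finset.sum_congr rfl fun j _ => ?_
    simp only [unusedService, castMat, Pi.sub_apply, Pi.add_apply]; ring
  set r' := (rowSum z (nextQueue x a s) : ℝ) with hr'
  set V := √(perpSq z (nextQueue x a s)) with hV
  have hV2 : V ^ 2 = perpSq z (nextQueue x a s) := Real.sq_sqrt (perpSq_nonneg z _)
  have h1 : U * (r' / n) ≤ U * V := by
    rw [hU, Finset.sum_mul, Finset.sum_mul]
    refine Finset.sum_le_sum fun j _ => ?_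
    have h2 := (abs_le.1 (abs_le_sqrt_matInner (matPerp z (castMat (nextQueue x a s))) z j)).1
    change -V ≤ _ at h2
    have h3 : matPerp z (castMat (nextQueue x a s)) z j =
        castMat (nextQueue x a s) z j - r' / n := by
      simp [matPerp, hr', rowSum, castMat]
    rw [h3] at h2
    have h4 := (hspec j).2.2.2
    nlinarith [(hspec j).1]
  have h2 : U * r' ≤ n * (U * V) := by
    have := mul_le_mul_of_nonneg_left h1 hn.le
    calc U * r' = n * (U * (r' / n)) := by field_simp
      _ ≤ _ := this
  -- Young's inequality for `V`, combined with `0 ≤ U ≤ 1`.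
  have h3 : U * V ≤ L * U + V ^ 2 / L := by
    have h4 : V ≤ L + V ^ 2 / L := by
      rw [← sub_nonneg]
      have : L + V ^ 2 / L - V = ((L - V / 2) ^ 2 + 3 / 4 * V ^ 2) / L := by field_simp; ring
      rw [this]; positivity
    have h5 : 0 ≤ V ^ 2 / L := by positivity
    nlinarith
  have h6 : r' - rowSum z x - rowSum z a + 1 = U := by rw [hr]; ring
  rw [h6, ← hV2]
  have h7 : (rowSum z x : ℝ) + (rowSum z a - 1) = r' - U := by rw [hr]; ring
  rw [h7]
  have h8 : n * (U * V) ≤ n * (L * U + V ^ 2 / L) := mul_le_mul_of_nonneg_left h3 hn.le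
  nlinarith [sq_nonneg U]

end Pointwise

end Drift

/-! ### Mean drifts under MaxWeight -/

section MaxWeightDrift

variable {n : ℕ} {A : PMF (SwitchMat n)} {amax : ℕ} {ν : Fin n → Fin n → ℝ} {ε : ℝ}
  {x s : SwitchMat n}

lemma IsArrivalLaw.integral_matInner {lam : Fin n → Fin n → ℝ} (hA : IsArrivalLaw A amax lam)
    (y : Fin n → Fin n → ℝ) (s : SwitchMat n) :
    ∫ a, matInner y (castMat a - castMat s) ∂A.toMeasure = matInner y (lam - castMat s) := by
  have h : ∫ a, matInner y (castMat a) ∂A.toMeasure = matInner y lam := by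
    simp only [matInner, castMat]
    rw [integral_finsetSum _ fun i _ => hA.integrable _]
    refine Finset.sum_congr rfl fun i _ => ?_
    rw [integral_finsetSum _ fun j _ => hA.integrable _]
    refine Finset.sum_congr rfl fun j _ => ?_
    rw [integral_const_mul, hA.mean]
  simp only [matInner_sub_right]
  rw [integral_sub (hA.integrable _) (integrable_const _), h]
  simp

lemma IsArrivalLaw.integral_le_of_le {lam : Fin n → Fin n → ℝ} (hA : IsArrivalLaw A amax lam)
    {F G : SwitchMat n → ℝ} (h : ∀ a, (∀ i j, a i j ≤ amax) → F a ≤ G a) :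
    ∫ a, F a ∂A.toMeasure ≤ ∫ a, G a ∂A.toMeasure :=
  integral_mono_ae (hA.integrable _) (hA.integrable _)
    (A.ae_iff_forall_mem_support.2 fun a ha => h a fun i j => hA.bounded a ha i j)

lemma IsArrivalLaw.integral_affine {lam : Fin n → Fin n → ℝ} (hA : IsArrivalLaw A amax lam)
    (y : Fin n → Fin n → ℝ) (s : SwitchMat n) (c d : ℝ) :
    ∫ a, (c * matInner y (castMat a - castMat s) + d) ∂A.toMeasure =
      c * matInner y (lam - castMat s) + d := by
  rw [integral_add (hA.integrable _) (integrable_const _), integral_const_mul,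
    hA.integral_matInner]
  simp

/-- The drift of the sum of the squares of the queue lengths. -/
lemma IsArrivalLaw.integral_matInner_nextQueue_le
    (hA : IsArrivalLaw A amax fun i j => (1 - ε) * ν i j) (hν : ν ∈ capacityRegion n)
    (hs : IsMaxWeightSchedule x s) :
    ∫ a, matInner (castMat (nextQueue x a s)) (castMat (nextQueue x a s)) ∂A.toMeasure ≤
      matInner (castMat x) (castMat x) - 2 * ε * matInner (castMat x) ν +
        n ^ 2 * (amax + 1) ^ 2 := by
  refine (hA.integral_le_of_le (G := fun a => 2 * matInner (castMat x) (castMat a - castMat s) +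
    (matInner (castMat x) (castMat x) + n ^ 2 * (amax + 1) ^ 2)) fun a ha => ?_).trans ?_
  · have := hs.1.matInner_nextQueue_le (x := x) ha
    linarith
  · rw [hA.integral_affine, matInner_sub_right]
    have h1 := hs.matInner_le hν
    have h2 : matInner (castMat x) (fun i j => (1 - ε) * ν i j) = (1 - ε) * matInner (castMat x) ν :=
      matInner_smul_right _ _ _
    rw [h2]
    linarith

/-- Comparison with `ν` moved by `δ` in the normalized direction of the projected queues gains `δ
V`. Both `ν` and the schedule have row sum `1` at `z`, so projecting the queues does not alter the
gain. The factor `1 - ε` costs at most `n * ε * V`, half of the gain. -/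
lemma IsMaxWeightSchedule.matInner_matPerp_le (hs : IsMaxWeightSchedule x s)
    (hν : ν ∈ capacityRegion n) {z : Fin n} (hz : ∑ j, ν z j = 1) {δ : ℝ}
    (hδ : ∀ d : Fin n → Fin n → ℝ, (∀ i j, |d i j| ≤ 1) → ∑ j, d z j = 0 →
      ν + δ • d ∈ capacityRegion n) (hε0 : 0 ≤ ε) (hε : n * ε ≤ δ / 2) :
    2 * matInner (matPerp z (castMat x)) ((fun i j => (1 - ε) * ν i j) - castMat s) ≤
      -δ * √(perpSq z x) := by
  set V := √(perpSq z x) with hV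
  have hV0 : 0 ≤ V := Real.sqrt_nonneg _
  have hperp : ∀ i j, |matPerp z (castMat x) i j| ≤ V := abs_le_sqrt_matInner _
  have h1 : matInner (castMat x) ν + δ * V ≤ matInner (castMat x) (castMat s) := by
    -- For `V = 0` the inverse is `0` by convention, and the direction is harmlessly zero.
    have h := hs.matInner_le (hδ (V⁻¹ • matPerp z (castMat x)) (fun i j => ?_) ?_)
    · rw [matInner_add_right, matInner_smul_right, matInner_smul_right,
        matInner_matPerp_self_eq] at h
      have h2 : V⁻¹ * perpSq z x = V := by
        rw [mul_comm, ← div_eq_mul_inv, hV, Real.div_sqrt]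
      change _ + δ * (V⁻¹ * perpSq z x) ≤ _ at h
      rwa [h2] at h
    · simp only [Pi.smul_apply, smul_eq_mul]
      rw [abs_mul, abs_inv, abs_of_nonneg hV0]
      exact (mul_le_mul_of_nonneg_left (hperp i j) (inv_nonneg.2 hV0)).trans
        (inv_mul_le_one_of_le₀ le_rfl hV0)
    · simp only [Pi.smul_apply, smul_eq_mul, ← Finset.mul_sum, sum_matPerp, mul_zero]
  have h2 : matInner (matPerp z (castMat x)) (ν - castMat s) =
      matInner (castMat x) (ν - castMat s) := by
    refine matInner_matPerp_left_of_sum_eq_zero z _ ?_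
    have : ∑ j, (s z j : ℝ) = 1 := by exact_mod_cast hs.1.1 z
    simp [castMat, hz, this]
  have h3 : -matInner (matPerp z (castMat x)) ν ≤ n * V := by
    have : -matInner (matPerp z (castMat x)) ν ≤ ∑ i, ∑ j, V * ν i j := by
      rw [matInner, ← Finset.sum_neg_distrib]
      refine Finset.sum_le_sum fun i _ => ?_
      rw [← Finset.sum_neg_distrib]
      refine Finset.sum_le_sum fun j _ => ?_
      nlinarith [(abs_le.1 (hperp i j)).1, hν.1 i j]
    refine this.trans ?_
    have h4 : ∑ i, ∑ j, V * ν i j ≤ ∑ _i : Fin n, V := Finset.sum_le_sum fun i _ => by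
      rw [← Finset.mul_sum]
      exact mul_le_of_le_one_right hV0 (hν.2.1 i)
    simpa using h4
  have h4 : (fun i j => (1 - ε) * ν i j) - castMat s = (ν - castMat s) + (-ε) • ν := by
    ext i j; simp; ring
  rw [h4, matInner_add_right, matInner_smul_right, h2, matInner_sub_right]
  have h5 : ε * -matInner (matPerp z (castMat x)) ν ≤ ε * (n * V) :=
    mul_le_mul_of_nonneg_left h3 hε0
  have h6 : n * ε * V ≤ δ / 2 * V := mul_le_mul_of_nonneg_right hε hV0
  linarith

/-- The drift of the squared distance from the line of state space collapse. -/
lemma IsArrivalLaw.integral_perpSq_le (hA : IsArrivalLaw A amax fun i j => (1 - ε) * ν i j)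
    (hs : IsMaxWeightSchedule x s) {z : Fin n} {δ : ℝ}
    (h : 2 * matInner (matPerp z (castMat x)) ((fun i j => (1 - ε) * ν i j) - castMat s) ≤
      -δ * √(perpSq z x)) :
    ∫ a, perpSq z (nextQueue x a s) ∂A.toMeasure ≤
      perpSq z x - δ * √(perpSq z x) + n ^ 2 * (amax + 1) ^ 2 := by
  refine (hA.integral_le_of_le (G := fun a =>
    2 * matInner (matPerp z (castMat x)) (castMat a - castMat s) +
    (perpSq z x + n ^ 2 * (amax + 1) ^ 2)) fun a ha => ?_).trans ?_
  · have := (hs.1.perpSq_nextQueue (x := x) ha z).1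
    linarith
  · rw [hA.integral_affine]
    linarith

/-- Either the cubic term dominates, or `V` is below `C / (2 * δ)` and it may be dropped. -/
lemma cubic_le {δ C V : ℝ} (hδ : 0 < δ) (hC : 0 ≤ C) (hV : 0 ≤ V) :
    C * V ^ 2 - 2 * δ * V ^ 3 ≤ C ^ 3 / (4 * δ ^ 2) := by
  rcases le_or_gt C (2 * δ * V) with h | h
  · have h1 : C * V ^ 2 - 2 * δ * V ^ 3 = (C - 2 * δ * V) * V ^ 2 := by ring
    have h2 : (C - 2 * δ * V) * V ^ 2 ≤ 0 :=
      mul_nonpos_of_nonpos_of_nonneg (by linarith) (sq_nonneg V)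
    have h3 : 0 ≤ C ^ 3 / (4 * δ ^ 2) := by positivity
    linarith
  · rw [le_div_iff₀ (by positivity)]
    have h1 : (2 * δ * V) ^ 2 ≤ C ^ 2 := by
      have : 0 ≤ 2 * δ * V := by positivity
      gcongr
    have h2 : 0 ≤ 2 * δ * V ^ 3 * (4 * δ ^ 2) := by positivity
    nlinarith [mul_le_mul_of_nonneg_left h1 hC]

/-- The drift of the fourth power of the distance from the line of state space collapse, with
constants that do not depend on the load. -/
lemma exists_integral_perpSq_sq_le (n amax : ℕ) {δ : ℝ} (hδ : 0 < δ) :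
    ∃ C : ℝ, 0 ≤ C ∧ ∀ {A : PMF (SwitchMat n)} {ν : Fin n → Fin n → ℝ} {ε : ℝ}
      {x s : SwitchMat n} {z : Fin n}, IsArrivalLaw A amax (fun i j => (1 - ε) * ν i j) →
      IsMaxWeightSchedule x s →
      2 * matInner (matPerp z (castMat x)) ((fun i j => (1 - ε) * ν i j) - castMat s) ≤
        -δ * √(perpSq z x) →
      ∫ a, perpSq z (nextQueue x a s) ^ 2 ∂A.toMeasure ≤
        perpSq z x ^ 2 - perpSq z x + C := by
  set K : ℝ := n ^ 2 * (amax + 1) ^ 2 with hK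
  set D : ℝ := n ^ 2 * (amax + 1) with hD
  set B : ℝ := amax + 1 with hB
  have hK0 : 0 ≤ K := by positivity
  have hD0 : 0 ≤ D := by positivity
  have hB0 : 0 ≤ B := by positivity
  -- The coefficient of `W` gathers `2 * K` from the cross term, `8 * D ^ 2` from the squared
  -- increment, and `1` for the desired drift `-W`; the cubic term `-2 * δ * V ^ 3` beats them all.
  set C₁ : ℝ := 2 * K + 8 * D ^ 2 + 1 with hC₁
  refine ⟨C₁ ^ 3 / (4 * δ ^ 2) + 2 * D ^ 2 * B ^ 2, by positivity, ?_⟩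
  intro A ν ε x s z hA hs h
  set V := √(perpSq z x) with hV
  have hV0 : 0 ≤ V := Real.sqrt_nonneg _
  have hW0 := perpSq_nonneg z x
  have hV2 : V ^ 2 = perpSq z x := Real.sq_sqrt hW0
  set W := perpSq z x with hW
  refine (hA.integral_le_of_le (G := fun a =>
    4 * W * matInner (matPerp z (castMat x)) (castMat a - castMat s) +
    (W ^ 2 + 2 * W * K + D ^ 2 * (8 * W + 2 * B ^ 2))) fun a ha => ?_).trans ?_
  · obtain ⟨h1, h2⟩ := hs.1.perpSq_nextQueue (x := x) ha z
    have h3 : (perpSq z (nextQueue x a s) - W) ^ 2 ≤ (D * (2 * V + B)) ^ 2 :=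
      sq_le_sq' (abs_le.1 h2).1 (abs_le.1 h2).2
    have h4 : (D * (2 * V + B)) ^ 2 ≤ D ^ 2 * (8 * W + 2 * B ^ 2) := by
      rw [mul_pow, ← hV2]
      refine mul_le_mul_of_nonneg_left ?_ (sq_nonneg D)
      nlinarith [sq_nonneg (2 * V - B)]
    have h5 := mul_le_mul_of_nonneg_left h1 hW0
    nlinarith
  · rw [hA.integral_affine]
    have h1 := mul_le_mul_of_nonneg_left h hW0
    have h2 := cubic_le hδ (by positivity : 0 ≤ C₁) hV0
    have h3 : V ^ 3 = W * V := by rw [← hV2]; ring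
    rw [h3, hV2] at h2
    rw [hC₁] at h2 ⊢
    linarith

/-- The drift of the Lyapunov function for the upper bound on the content of the saturated input
port. -/
lemma IsArrivalLaw.integral_rowSum_perpSq_le
    (hA : IsArrivalLaw A amax fun i j => (1 - ε) * ν i j) (hs : IsMaxWeightSchedule x s)
    {z : Fin n} (hz : ∑ j, ν z j = 1) {δ C L : ℝ} (hδ : 0 ≤ δ) (hL : 0 < L)
    (h : 2 * matInner (matPerp z (castMat x)) ((fun i j => (1 - ε) * ν i j) - castMat s) ≤
      -δ * √(perpSq z x))
    (hC : ∫ a, perpSq z (nextQueue x a s) ^ 2 ∂A.toMeasure ≤ perpSq z x ^ 2 - perpSq z x + C) :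
    ∫ a, (((rowSum z (nextQueue x a s) : ℝ) - n * L) ^ 2 +
        2 * n / L * perpSq z (nextQueue x a s) ^ 2) ∂A.toMeasure ≤
      ((rowSum z x : ℝ) - n * L) ^ 2 + 2 * n / L * perpSq z x ^ 2 - 2 * ε * rowSum z x +
      (∑ j, arrivalVar A z j + ε ^ 2 + 2 * n * L * ε +
        2 * n / L * (n ^ 2 * (amax + 1) ^ 2 + C)) := by
  have hε : ∑ j, (1 - ε) * ν z j = 1 - ε := by rw [← Finset.mul_sum, hz, mul_one]
  set r : ℝ := ((rowSum z x : ℕ) : ℝ) with hr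
  set α : SwitchMat n → ℝ := fun a => (rowSum z a : ℝ) - 1 with hα
  set c : ℝ := 2 * n / L with hc
  have hc0 : 0 ≤ c := by positivity
  have hα1 : ∫ a, α a ∂A.toMeasure = -ε := by
    rw [hα, integral_sub (hA.integrable _) (integrable_const _), hA.integral_rowSum, hε]
    simp
  have hα2 := hA.integral_rowSum_sub_one_sq hε
  have hW1 := hA.integral_perpSq_le hs h
  have hW2 : 0 ≤ δ * √(perpSq z x) := mul_nonneg hδ (Real.sqrt_nonneg _)
  -- The shift by `n * L` cancels the new content in the wasted-service term. What remains of that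
  -- term is `c` times the new `perpSq`, whose mean is offset by the drift of `c` times its square.
  refine (hA.integral_le_of_le (G := fun a => ((2 * r - 2 * n * L) * α a + α a ^ 2 +
    ((r - n * L) ^ 2)) + (c * perpSq z (nextQueue x a s) +
      c * perpSq z (nextQueue x a s) ^ 2)) fun a ha => ?_).trans ?_
  · have h1 := hs.1.rowSum_nextQueue_sq_le (x := x) (a := a) z hL
    have h2 : 2 * n * (perpSq z (nextQueue x a s) / L) = c * perpSq z (nextQueue x a s) := by
      rw [hc]; ring
    simp only [hα]
    nlinarith
  · rw [integral_add (hA.integrable _) (hA.integrable _),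
      integral_add (hA.integrable _) (integrable_const _),
      integral_add (hA.integrable _) (hA.integrable _),
      integral_add (hA.integrable _) (hA.integrable _), integral_const_mul, integral_const_mul,
      integral_const_mul, hα1, hα2]
    simp only [integral_const, probReal_univ, one_smul]
    have h1 := mul_le_mul_of_nonneg_left hW1 hc0
    have h2 := mul_le_mul_of_nonneg_left hC hc0
    have h3 := mul_nonneg hc0 hW2
    linarith

end MaxWeightDrift

/-! ### The queue-length chain of MaxWeight and its steady state -/

section MaxWeightChain

variable {n : ℕ}

/-- The transition probabilities of the queue lengths when the schedule has law `r x` for queue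
lengths `x`. -/
noncomputable def queueKernel (A : PMF (SwitchMat n)) (r : SwitchMat n → PMF (SwitchMat n))
    (x : SwitchMat n) : PMF (SwitchMat n) :=
  (r x).bind fun s => A.map fun a => nextQueue x a s

/-- The choice depends on the current queues only, so the rest of the history can be forgotten and
the queues alone form a Markov chain. -/
lemma queueLaw_eq_markovLaw {A : PMF (SwitchMat n)} {p : SchedulingPolicy n}
    {r : SwitchMat n → PMF (SwitchMat n)} (hp : ∀ h, p.choose h = r h.1)
    (init : PMF (SwitchMat n)) (t : ℕ) :
    queueLaw A p init t = markovLaw (queueKernel A r) init t := by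
  induction t with
  | zero =>
    rw [queueLaw, historyLaw, PMF.map_comp, markovLaw]
    exact PMF.map_id init
  | succ t ih =>
    rw [markovLaw, ← ih, queueLaw, historyLaw, queueLaw, PMF.map_bind, PMF.bind_map]
    congr 1
    ext1 h
    rw [switchStep, PMF.map_bind, hp]
    simp only [PMF.map_comp]
    rfl

lemma hasDrift_queueKernel {A : PMF (SwitchMat n)} {amax : ℕ} {lam : Fin n → Fin n → ℝ}
    (hA : IsArrivalLaw A amax lam) {r : SwitchMat n → PMF (SwitchMat n)}
    (hr : ∀ x, ∀ s ∈ (r x).support, IsMaxWeightSchedule x s) {f g : SwitchMat n → ℝ} {b : ℝ}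
    (hf : ∀ x, 0 ≤ f x) (h : ∀ x s, IsMaxWeightSchedule x s →
      ∫ a, f (nextQueue x a s) ∂A.toMeasure ≤ f x - g x + b) :
    HasDrift (queueKernel A r) f g b := by
  intro x
  have h1 : pmfExp (queueKernel A r x) (fun y => ENNReal.ofReal (f y)) ≤
      ENNReal.ofReal (f x - g x + b) := by
    rw [queueKernel, pmfExp_bind, ← pmfExp_const (r x) (ENNReal.ofReal (f x - g x + b))]
    refine pmfExp_mono fun s hs => ?_
    rw [pmfExp_map, pmfExp_ofReal A (hA.integrable _) fun _ => hf _]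
    exact ENNReal.ofReal_le_ofReal (h x s (hr x s hs))
  obtain ⟨s, hs⟩ := (r x).support_nonempty
  have h2 : 0 ≤ f x - g x + b :=
    (integral_nonneg fun _ => hf _).trans (h x s (hr x s hs))
  exact ⟨integrable_of_pmfExp_le _ hf h1, integral_le_of_pmfExp_le _ hf h2 h1⟩

/-- By independence the probability of no arrivals is a product. A zero factor would force at least
one arrival per slot at some queue, hence mean rate at least `1`. -/
lemma IsArrivalLaw.zero_mem_support {A : PMF (SwitchMat n)} {amax : ℕ} {lam : Fin n → Fin n → ℝ}
    (hA : IsArrivalLaw A amax lam) (hlam : ∀ i j, lam i j < 1) : (0 : SwitchMat n) ∈ A.support := by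
  have h1 := hA.indep.measure_inter_preimage_eq_mul (Finset.univ)
    (sets := fun _ => {0}) (fun _ _ => MeasurableSet.singleton _)
  have h2 : (⋂ ij ∈ (Finset.univ : Finset (Fin n × Fin n)),
      (fun a : SwitchMat n => a ij.1 ij.2) ⁻¹' {0}) = {0} := by
    ext a
    simp only [Finset.mem_univ, Set.iInter_true, Set.mem_iInter, Set.mem_preimage,
      Set.mem_singleton_iff, Prod.forall]
    exact ⟨fun h => funext fun i => funext fun j => h i j, fun h i j => by simp [h]⟩
  rw [h2, PMF.toMeasure_apply_singleton _ _ (MeasurableSet.singleton _)] at h1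
  rw [PMF.mem_support_iff, h1, Finset.prod_ne_zero_iff]
  rintro ⟨i, j⟩ - h0
  have h3 : ∀ a ∈ A.support, (1 : ℝ) ≤ a i j := fun a ha => by
    have h4 : a ∉ (fun a : SwitchMat n => a i j) ⁻¹' {0} := fun hm =>
      Set.disjoint_left.1 ((PMF.toMeasure_apply_eq_zero_iff _
        (Set.to_countable _).measurableSet).1 h0) ha hm
    have h5 : a i j ≠ 0 := h4
    exact_mod_cast Nat.one_le_iff_ne_zero.2 h5
  have h4 := integral_mono_ae (integrable_const (1 : ℝ)) (hA.integrable fun a => (a i j : ℝ))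
    (A.ae_iff_forall_mem_support.2 h3)
  rw [hA.mean] at h4
  have := hlam i j
  simp only [integral_const, probReal_univ, one_smul] at h4
  linarith

/-- Without arrivals, MaxWeight reduces the number of packets. -/
lemma IsMaxWeightSchedule.sum_nextQueue_lt {x s : SwitchMat n} (hs : IsMaxWeightSchedule x s)
    (hx : x ≠ 0) : ∑ i, ∑ j, nextQueue x 0 s i j < ∑ i, ∑ j, x i j := by
  have hle : ∀ i j, nextQueue x 0 s i j ≤ x i j := fun i j => by simp [nextQueue]
  obtain ⟨i₀, j₀, h0⟩ : ∃ i j, x i j ≠ 0 := by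
    by_contra! h
    exact hx (funext fun i => funext fun j => h i j)
  -- Serving a single nonempty queue has positive weight, so the MaxWeight schedule also serves some
  -- nonempty queue.
  set s' : SwitchMat n := fun i j => if i = i₀ ∧ j = j₀ then 1 else 0 with hs'
  have hsched : IsSchedule s' := by
    refine ⟨fun i => ?_, fun j => ?_⟩
    · by_cases hi : i = i₀ <;> simp [hs', hi]
    · by_cases hj : j = j₀ <;> simp [hs', hj]
  have h1 : 0 < scheduleWeight x s := by
    refine lt_of_lt_of_le ?_ (hs.2 s' hsched)
    refine (Nat.pos_of_ne_zero h0).trans_le ?_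
    have h2 : x i₀ j₀ = x i₀ j₀ * s' i₀ j₀ := by simp [hs']
    rw [h2]
    refine (Finset.single_le_sum (f := fun j => x i₀ j * s' i₀ j) (fun _ _ => Nat.zero_le _)
      (Finset.mem_univ j₀)).trans ?_
    exact Finset.single_le_sum (f := fun i => ∑ j, x i j * s' i j) (fun _ _ => Nat.zero_le _)
      (Finset.mem_univ i₀)
  obtain ⟨i, -, hi⟩ := Finset.exists_ne_zero_of_sum_ne_zero h1.ne'
  obtain ⟨j, -, hij⟩ := Finset.exists_ne_zero_of_sum_ne_zero hi
  have hxj : x i j ≠ 0 := left_ne_zero_of_mul hij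
  have hsj : s i j ≠ 0 := right_ne_zero_of_mul hij
  refine Finset.sum_lt_sum (fun i _ => Finset.sum_le_sum fun j _ => hle i j)
    ⟨i, Finset.mem_univ i, Finset.sum_lt_sum (fun j _ => hle i j) ⟨j, Finset.mem_univ j, ?_⟩⟩
  simp only [nextQueue, Pi.zero_apply]
  omega

lemma finite_of_forall_le {T : Set (SwitchMat n)} {B : Fin n → Fin n → ℝ}
    (h : ∀ x ∈ T, ∀ i j, (x i j : ℝ) ≤ B i j) : T.Finite :=
  (Set.Finite.pi' fun i => Set.Finite.pi' fun j => Set.finite_Iic ⌊B i j⌋₊).subset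
    fun x hx i j => Nat.le_floor (h x hx i j)

lemma cast_le_of_sq_le {k : ℕ} {c : ℝ} (h : (k : ℝ) ^ 2 ≤ c) : (k : ℝ) ≤ c := by
  refine le_trans ?_ h
  exact_mod_cast Nat.le_self_pow two_ne_zero k

/-- MaxWeight stabilizes the switch: convergence to the steady state. -/
lemma IsArrivalLaw.exists_queueConvergesTo {A : PMF (SwitchMat n)} {amax : ℕ}
    {ν : Fin n → Fin n → ℝ} {ε : ℝ} (hε : ε ∈ Set.Ioo (0 : ℝ) 1)
    (hA : IsArrivalLaw A amax fun i j => (1 - ε) * ν i j) (hν : ν ∈ capacityRegion n)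
    (hν_pos : ∀ i j, 0 < ν i j) {p : SchedulingPolicy n} (hp : p.IsMaxWeight) :
    ∃ π : PMF (SwitchMat n), ∀ init, QueueConvergesTo A p init π := by
  obtain ⟨r, hpr, hr⟩ := hp
  -- The decrease `2 * ε * matInner (castMat x) ν` is coercive because all entries of `ν` are
  -- positive.
  have hd := hasDrift_queueKernel hA (r := r) (fun x s hs => hr x s hs)
    (f := fun x => matInner (castMat x) (castMat x))
    (g := fun x => 2 * ε * matInner (castMat x) ν) (fun x => matInner_self_nonneg _)
    (fun x s hs => hA.integral_matInner_nextQueue_le hν hs)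
  have hterm : ∀ (x : SwitchMat n) i j, 0 ≤ castMat x i j * ν i j := fun x i j =>
    mul_nonneg (Nat.cast_nonneg _) (hν.1 i j)
  have hν0 : ∀ x : SwitchMat n, 0 ≤ matInner (castMat x) ν := fun x =>
    Finset.sum_nonneg fun i _ => Finset.sum_nonneg fun j _ => hterm x i j
  have hε2 : 0 < 2 * ε := by linarith [hε.1]
  have h0A : (0 : SwitchMat n) ∈ A.support := hA.zero_mem_support fun i j => by
    have h1 : ν i j ≤ 1 := (Finset.single_le_sum (f := fun j => ν i j) (fun j _ => hν.1 i j)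
      (Finset.mem_univ j)).trans (hν.2.1 i)
    have := hν_pos i j
    nlinarith [hε.1, hε.2]
  obtain ⟨π, hπ⟩ := hd.exists_tendsto (o := 0) (ℓ := fun x => ∑ i, ∑ j, x i j)
    (fun x => matInner_self_nonneg _) (fun x => mul_nonneg hε2.le (hν0 x)) (by positivity)
    (fun R => finite_of_forall_le (B := fun _ _ => R) fun x hx i j =>
      cast_le_of_sq_le ((sq_le_matInner_self (castMat x) i j).trans hx))
    (fun R => finite_of_forall_le (B := fun i j => R / (2 * ε * ν i j)) fun x hx i j => by
      rw [le_div_iff₀ (mul_pos hε2 (hν_pos i j))]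
      have h1 : castMat x i j * ν i j ≤ matInner (castMat x) ν :=
        (Finset.single_le_sum (f := fun j => castMat x i j * ν i j) (fun j _ => hterm x i j)
          (Finset.mem_univ j)).trans (Finset.single_le_sum
            (f := fun i => ∑ j, castMat x i j * ν i j)
            (fun i _ => Finset.sum_nonneg fun j _ => hterm x i j) (Finset.mem_univ i))
      have h2 : 2 * ε * matInner (castMat x) ν ≤ R := hx
      have h3 := mul_le_mul_of_nonneg_left h1 hε2.le
      simp only [castMat] at h1 h2 h3
      linarith)
    (fun x => by
      -- A slot without arrivals has positive probability: it reduces the total content, and keeps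
      -- an empty switch empty.
      obtain ⟨s, hs⟩ := (r x).support_nonempty
      have hmem : nextQueue x 0 s ∈ (queueKernel A r x).support := by
        rw [queueKernel, PMF.mem_support_bind_iff]
        refine ⟨s, hs, ?_⟩
        rw [PMF.mem_support_map_iff]
        exact ⟨0, h0A, rfl⟩
      refine ⟨_, hmem, ?_⟩
      by_cases hx : x = 0
      · refine Or.inr ⟨hx, ?_⟩
        ext i j
        simp [hx, nextQueue]
      · exact Or.inl (IsMaxWeightSchedule.sum_nextQueue_lt (hr x s hs) hx))
  refine ⟨π, fun init q => ?_⟩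
  simp only [queueLaw_eq_markovLaw hpr]
  exact hπ init q

lemma pmfExp_const_mul {α : Type*} (p : PMF α) (c : ℝ≥0∞) (F : α → ℝ≥0∞) :
    pmfExp p (fun x => c * F x) = c * pmfExp p F := by
  simp only [pmfExp, ← ENNReal.tsum_mul_left]
  exact tsum_congr fun x => by ring

/-- Bounds for the steady state of MaxWeight: state space collapse, and the content of the
saturated input port. -/
lemma exists_steadyState_bounds (n amax : ℕ) {ν : Fin n → Fin n → ℝ} (hν : ν ∈ capacityRegion n)
    {z : Fin n} (hz : ∑ j, ν z j = 1) {δ : ℝ} (hδ0 : 0 < δ)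
    (hδ : ∀ d : Fin n → Fin n → ℝ, (∀ i j, |d i j| ≤ 1) → ∑ j, d z j = 0 →
      ν + δ • d ∈ capacityRegion n) :
    ∃ C : ℝ, 0 ≤ C ∧ ∀ {ε : ℝ}, 0 < ε → n * ε ≤ δ / 2 → ∀ {A π : PMF (SwitchMat n)}
      {p : SchedulingPolicy n}, IsArrivalLaw A amax (fun i j => (1 - ε) * ν i j) →
      p.IsMaxWeight → QueueConvergesTo A p (PMF.pure 0) π →
      (∀ i j, i ≠ z → meanQueue π i j ≤ ENNReal.ofReal C) ∧
      ENNReal.ofReal ε * meanRowQueue π z ≤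
        ENNReal.ofReal ((∑ j, arrivalVar A z j + ε ^ 2 + C * √ε) / 2) := by
  obtain ⟨C, hC0, hC⟩ := exists_integral_perpSq_sq_le n amax hδ0
  set K : ℝ := n ^ 2 * (amax + 1) ^ 2 with hK
  have hK0 : 0 ≤ K := by positivity
  refine ⟨C + 2 * n * (1 + K + C), by positivity, ?_⟩
  intro ε hε0 hε A π p hA hp hconv
  obtain ⟨r, hpr, hr⟩ := hp
  have hπ : ∀ q, Tendsto (fun t => markovLaw (queueKernel A r) (PMF.pure 0) t q) atTop
      (𝓝 (π q)) := fun q => by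
    simp only [← queueLaw_eq_markovLaw hpr]
    exact hconv q
  have hperp : ∀ x s, IsMaxWeightSchedule x s → _ := fun x s hs =>
    hs.matInner_matPerp_le hν hz hδ hε0.le hε
  constructor
  · intro i j hij
    -- The fourth power serves as Lyapunov function because its decrease is the squared distance,
    -- which bounds each queue off the saturated row.
    have hd := hasDrift_queueKernel hA (r := r) (fun x s hs => hr x s hs)
      (f := fun x => perpSq z x ^ 2) (g := perpSq z) (fun x => sq_nonneg _)
      (fun x s hs => hC hA hs (hperp x s hs))
    have h1 := hd.pmfExp_le (fun x => sq_nonneg _) (perpSq_nonneg z) hC0 hπ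
    rw [meanQueue_eq_pmfExp]
    refine (pmfExp_mono fun x _ => ?_).trans (h1.trans
      (ENNReal.ofReal_le_ofReal (le_add_of_nonneg_right (by positivity))))
    rw [← ENNReal.ofReal_natCast]
    refine ENNReal.ofReal_le_ofReal (cast_le_of_sq_le ?_)
    have h2 := sq_le_matInner_self (matPerp z (castMat x)) i j
    have h3 : matPerp z (castMat x) i j = x i j := by simp [matPerp, hij, castMat]
    rwa [h3] at h2
  -- This choice balances the error terms `2 * n * L * ε` and `2 * n / L * (K + C)`; both become of
  -- order `√ε`.
  · set L : ℝ := (√ε)⁻¹ with hL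
    have hsε : 0 < √ε := Real.sqrt_pos.2 hε0
    have hL0 : 0 < L := inv_pos.2 hsε
    have hvar : 0 ≤ ∑ j, arrivalVar A z j := Finset.sum_nonneg fun j _ => variance_nonneg _ _
    have hd := hasDrift_queueKernel hA (r := r) (fun x s hs => hr x s hs)
      (f := fun x => ((rowSum z x : ℝ) - n * L) ^ 2 + 2 * n / L * perpSq z x ^ 2)
      (g := fun x => 2 * ε * rowSum z x) (fun x => by positivity)
      (fun x s hs => hA.integral_rowSum_perpSq_le hs hz hδ0.le hL0 (hperp x s hs)
        (hC hA hs (hperp x s hs)))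
    have h1 := hd.pmfExp_le (fun x => by positivity) (fun x => by positivity) (by positivity) hπ
    simp only [ENNReal.ofReal_mul (by positivity : 0 ≤ 2 * ε)] at h1
    rw [pmfExp_const_mul, ← meanRowQueue_eq_pmfExp] at h1
    have h2 := mul_le_mul_right h1 (ENNReal.ofReal (1 / 2))
    rw [← mul_assoc, ← ENNReal.ofReal_mul (by norm_num), ← ENNReal.ofReal_mul (by norm_num)] at h2
    have h3 : (1 / 2 : ℝ) * (2 * ε) = ε := by ring
    rw [h3] at h2
    refine h2.trans (ENNReal.ofReal_le_ofReal ?_)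
    have h4 : L * ε = √ε := by
      rw [hL, mul_comm, ← div_eq_mul_inv, Real.div_sqrt]
    have h5 : 2 * n / L = 2 * n * √ε := by rw [hL, div_inv_eq_mul]
    have h6 : 2 * n * L * ε = 2 * n * √ε := by rw [mul_assoc, h4]
    rw [h5, h6]
    have h7 : 0 ≤ C * √ε := by positivity
    linarith

end MaxWeightChain

/-! ### The heavy-traffic limit -/

theorem mainTheorem8 (n : ℕ) (hn : 1 < n)
    (ν : Fin n → Fin n → ℝ) (hν : ν ∈ intrinsicInterior ℝ (saturatedFace n 1 0))
    (hν_pos : ∀ i j, 0 < ν i j)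
    (amax : ℕ) (A : ℝ → PMF (SwitchMat n))
    (hA : ∀ ε ∈ Set.Ioo (0 : ℝ) 1, IsArrivalLaw (A ε) amax fun i j => (1 - ε) * ν i j)
    (σ : Fin n → Fin n → ℝ)
    (hσ : ∀ i j, Tendsto (fun ε => arrivalVar (A ε) i j) (𝓝[>] 0) (𝓝 (σ i j ^ 2)))
    (mw : ℝ → SchedulingPolicy n) (hmw : ∀ ε ∈ Set.Ioo (0 : ℝ) 1, (mw ε).IsMaxWeight) :
    ∃ π : ℝ → PMF (SwitchMat n),
      (∀ ε ∈ Set.Ioo (0 : ℝ) 1, ∀ init : PMF (SwitchMat n),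
        QueueConvergesTo (A ε) (mw ε) init (π ε)) ∧
      Tendsto (fun ε => ENNReal.ofReal ε * meanRowQueue (π ε) ⟨0, Nat.zero_lt_of_lt hn⟩) (𝓝[>] 0)
        (𝓝 (ENNReal.ofReal ((∑ j, σ ⟨0, Nat.zero_lt_of_lt hn⟩ j ^ 2) / 2))) ∧
      (∀ i : Fin n, 0 < i.val → ∀ j : Fin n,
        Tendsto (fun ε => ENNReal.ofReal ε * meanQueue (π ε) i j) (𝓝[>] 0) (𝓝 0)) ∧
      (∀ (p : ℝ → SchedulingPolicy n) (init π' : ℝ → PMF (SwitchMat n)),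
        (∀ ε ∈ Set.Ioo (0 : ℝ) 1, QueueConvergesTo (A ε) (p ε) (init ε) (π' ε)) →
        ENNReal.ofReal ((∑ j, σ ⟨0, Nat.zero_lt_of_lt hn⟩ j ^ 2) / 2) ≤
          liminf (fun ε => ENNReal.ofReal ε * meanRowQueue (π' ε) ⟨0, Nat.zero_lt_of_lt hn⟩)
            (𝓝[>] 0)) := by
  set z : Fin n := ⟨0, Nat.zero_lt_of_lt hn⟩ with hz
  have hmem := intrinsicInterior_subset hν
  have hcap : ν ∈ capacityRegion n := hmem.1
  have hνz : ∑ j, ν z j = 1 := hmem.2.1 z Nat.zero_lt_one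
  obtain ⟨δ, hδ0, hδ⟩ := exists_perturbation_mem_capacityRegion hn hν hν_pos
  obtain ⟨C, hC0, hC⟩ := exists_steadyState_bounds n amax hcap hνz hδ0 hδ
  -- Outside the interval `(0, 1)` the law is arbitrary; a point mass serves as default.
  have hex : ∀ ε, ∃ π : PMF (SwitchMat n), ε ∈ Set.Ioo (0 : ℝ) 1 →
      ∀ init, QueueConvergesTo (A ε) (mw ε) init π := fun ε => by
    by_cases hε : ε ∈ Set.Ioo (0 : ℝ) 1
    · obtain ⟨π, hπ⟩ := (hA ε hε).exists_queueConvergesTo hε hcap hν_pos (hmw ε hε)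
      exact ⟨π, fun _ => hπ⟩
    · exact ⟨PMF.pure 0, fun h => absurd h hε⟩
  choose π hπ using hex
  have hev : ∀ᶠ ε in 𝓝[>] (0 : ℝ), ε ∈ Set.Ioo (0 : ℝ) 1 :=
    Ioo_mem_nhdsGT zero_lt_one
  have hid : Tendsto (fun ε : ℝ => ε) (𝓝[>] 0) (𝓝 0) := tendsto_id.mono_left nhdsWithin_le_nhds
  have hsmall : ∀ᶠ ε in 𝓝[>] (0 : ℝ), n * ε ≤ δ / 2 := by
    have h1 : Tendsto (fun ε : ℝ => n * ε) (𝓝[>] 0) (𝓝 (n * 0)) := hid.const_mul _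
    rw [mul_zero] at h1
    exact (h1.eventually (gt_mem_nhds (half_pos hδ0))).mono fun ε h => le_of_lt h
  have hbd : ∀ ε, ε ∈ Set.Ioo (0 : ℝ) 1 → n * ε ≤ δ / 2 → _ := fun ε hε hε' =>
    hC hε.1 hε' (hA ε hε) (hmw ε hε) (hπ ε hε _)
  have hvar : Tendsto (fun ε => ∑ j, arrivalVar (A ε) z j) (𝓝[>] 0) (𝓝 (∑ j, σ z j ^ 2)) :=
    tendsto_finsetSum _ fun j _ => hσ z j
  have hlow : Tendsto (fun ε => ENNReal.ofReal ((∑ j, arrivalVar (A ε) z j + ε ^ 2 - ε) / 2))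
      (𝓝[>] 0) (𝓝 (ENNReal.ofReal ((∑ j, σ z j ^ 2) / 2))) := by
    have := ((hvar.add (hid.pow 2)).sub hid).div_const 2
    simp only [ne_eq, OfNat.ofNat_ne_zero, not_false_eq_true, zero_pow, add_zero, sub_zero] at this
    exact ENNReal.tendsto_ofReal this
  have hup : Tendsto (fun ε => ENNReal.ofReal ((∑ j, arrivalVar (A ε) z j + ε ^ 2 + C * √ε) / 2))
      (𝓝[>] 0) (𝓝 (ENNReal.ofReal ((∑ j, σ z j ^ 2) / 2))) := by
    have h1 : Tendsto (fun ε : ℝ => √ε) (𝓝[>] 0) (𝓝 √0) :=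
      (Real.continuous_sqrt.tendsto 0).comp hid
    have := ((hvar.add (hid.pow 2)).add (h1.const_mul C)).div_const 2
    simp only [ne_eq, OfNat.ofNat_ne_zero, not_false_eq_true, zero_pow, add_zero,
      Real.sqrt_zero, mul_zero] at this
    exact ENNReal.tendsto_ofReal this
  have hopt : ∀ (p : ℝ → SchedulingPolicy n) (init π' : ℝ → PMF (SwitchMat n)),
      (∀ ε ∈ Set.Ioo (0 : ℝ) 1, QueueConvergesTo (A ε) (p ε) (init ε) (π' ε)) →
      ∀ᶠ ε in 𝓝[>] (0 : ℝ), ENNReal.ofReal ((∑ j, arrivalVar (A ε) z j + ε ^ 2 - ε) / 2) ≤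
        ENNReal.ofReal ε * meanRowQueue (π' ε) z := fun p init π' h => by
    filter_upwards [hev] with ε hε
    exact (hA ε hε).le_mul_meanRowQueue hε.1 (by rw [← Finset.mul_sum, hνz, mul_one]) (h ε hε)
  refine ⟨π, hπ, ?_, ?_, ?_⟩
  -- The lower half of the squeeze is the universal bound, applied to MaxWeight itself.
  · refine tendsto_of_tendsto_of_tendsto_of_le_of_le' hlow hup
      (hopt mw (fun _ => PMF.pure 0) π fun ε hε => hπ ε hε _) ?_
    filter_upwards [hev, hsmall] with ε hε hε'
    exact (hbd ε hε hε').2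
  · intro i hi j
    have h1 : Tendsto (fun ε => ENNReal.ofReal (ε * C)) (𝓝[>] 0) (𝓝 0) := by
      have := ENNReal.tendsto_ofReal (hid.mul_const C)
      simpa using this
    refine tendsto_of_tendsto_of_tendsto_of_le_of_le' tendsto_const_nhds h1
      (.of_forall fun _ => zero_le) ?_
    filter_upwards [hev, hsmall] with ε hε hε'
    rw [ENNReal.ofReal_mul hε.1.le]
    have hiz : i ≠ z := fun h => by rw [h] at hi; simp [hz] at hi
    gcongr
    exact (hbd ε hε hε').1 i j hiz
  · intro p init π' h
    rw [← hlow.liminf_eq]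
    exact liminf_le_liminf (hopt p init π' h)
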